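/- Let $0<q<1$ and $\alpha>-1$. Write $(a;p)_n=\prod_{k=0}^{n-1}(1-ap^k)$, $(a;p)_\infty=\prod_{k\ge0}(1-ap^k)$, $(a_1,\dots,a_r;p)_n=\prod_i(a_i;p)_n$ (also for $n=\infty$), and, for $b>0$, $$\int_0^b\phi(x)\,d_px=(1-p)\sum_{n\ge0}bp^n\phi(bp^n),\qquad \int_0^\infty\phi(x)\,d_px=(1-p)\sum_{s\in\mathbb Z}p^s\phi(p^s).$$ Let $p_n^{(\alpha)}(x;p)$ be the monic $q$-Laguerre polynomial in base $p$, i.e. $$p_n^{(\alpha)}(x;p)=(-1)^np^{-n(n+\alpha)}(p^{\alpha+1};p)_n\sum_{k=0}^n\frac{(p^{-n};p)_k\,p^{\binom k2}\,p^{(n+\alpha+1)k}}{(p^{\alpha+1};p)_k\,(p;p)_k}\,x^k .$$ For a base $p\in(0,1)$ put $\rho(x;p)=x^\alpha/(-x;p)_\infty$, and put $$\omega(x;q)=\frac{q^{-\frac{\alpha+1}8}x^{\frac{\alpha-1}2}}{(-x;q)_\infty},\qquad \langle\phi,\psi\rangle_{1,\omega}=\int_0^\infty\!\int_0^{q^{1/2}y}\bigl(\phi(x)\psi(y)-\phi(y)\psi(x)\bigr)\omega(x;q)\,\omega(y;q)\,d_qx\,d_qy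 .$$ A sequence of monic real polynomials $(Q_n)_{n\ge0}$ with $\deg Q_n=n$ is called skew orthogonal for $\omega$ if $\langle Q_{2m},Q_{2n}\rangle_{1,\omega}=\langle Q_{2m+1},Q_{2n+1}\rangle_{1,\omega}=0$ and $\langle Q_{2m},Q_{2n+1}\rangle_{1,\omega}=u_m\delta_{m,n}$ with all $u_m\neq0$. Then all the series below converge absolutely (those in (1) and (2) also for arbitrary polynomials in place of the given ones), and: (1) $p_n^{(\alpha)}(x;q^{1/2})$ is monic of degree $n$, and for all $m,n\ge0$ $$\int_0^\infty p_m^{(\alpha)}(x;q^{1/2})\,p_n^{(\alpha)}(x;q^{1/2})\,\rho(x;q^{1/2})\,d_{q^{1/2}}x=\delta_{m,n}\,\tfrac{1-q^{1/2}}2\,q^{-n(n+\alpha)-\frac n2}\,\frac{(q^{\frac12},-q^{\frac{\alpha+1}2},-q^{-\frac\alpha2};q^{\frac12})_\infty}{(q^{\frac{\alpha+1}2},-q^{\frac12},-q^{\frac12};q^{\frac12})_\infty}\,(q^{\frac{\alpha+1}2},q^{\frac12};q^{\frac12})_n .$$ (2) The polynomials $$Q_{2n}(x)=p_{2n}^{(\alpha)}(x;q^{1/2}),\qquad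 Q_{2n+1}(x)=p_{2n+1}^{(\alpha)}(x;q^{1/2})-q^{-4n-\alpha}(1-q^n)(1-q^{n+\frac\alpha2})\,p_{2n-1}^{(\alpha)}(x;q^{1/2})$$ ($n\ge0$; the last term is absent for $n=0$) are skew orthogonal for $\omega$. The skew orthogonal sequences for $\omega$ are exactly those obtained from this one by replacing $Q_{2n+1}$ with $Q_{2n+1}+a_nQ_{2n}$ for arbitrary real constants $a_n$, and this sequence is the only one for which moreover $\int_0^\infty Q_{2n+1}(x)\,p_{2n}^{(\alpha)}(x;q^{1/2})\,\rho(x;q^{1/2})\,d_{q^{1/2}}x=0$ for all $n$. (3) The formulas in (2) (for all $n\ge0$) are equivalent to $$p_{2n}^{(\alpha)}(x;q^{1/2})=Q_{2n}(x),\qquad p_{2n+1}^{(\alpha)}(x;q^{1/2})=\sum_{j=0}^nq^{-(2j+2n+2+\alpha)(n-j)}\,(q^{j+1},q^{j+1+\frac\alpha2};q)_{n-j}\,Q_{2j+1}(x)\qquad(n\ge0).$$ (4) For all $n\ge0$, $$\int_{z_1=0}^\infty\int_{z_2=0}^{q^{1/2}z_1}\!\!\cdots\int_{z_{2n}=0}^{q^{1/2}z_{2n-1}}\prod_{1\le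 j<k\le2n}(z_j-z_k)\prod_{i=1}^{2n}\frac{z_i^{\frac{\alpha-1}2}}{(-z_i;q)_\infty}\,d_qz_i$$ $$=2^{-n}(1-q)^{2n}q^{-\frac13n(n-1)(4n+1+3\alpha)-\frac{\alpha+1}4n}\,\frac{(q^{\frac12},-q^{\frac{\alpha+1}2},-q^{-\frac\alpha2};q^{\frac12})_\infty^n}{(q^{\frac{\alpha+1}2},-q^{\frac12},-q^{\frac12};q^{\frac12})_\infty^n}\prod_{i=0}^{n-1}(q^{\frac{\alpha+1}2},q^{\frac12};q^{\frac12})_{2i}.$$ -/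

import Mathlib

open scoped Polynomial

noncomputable section

/-- The finite q-shifted factorial `(a;q)_n = ∏_{k<n} (1 - a q^k)`. -/
def qPoch (a q : ℝ) (n : ℕ) : ℝ := ∏ k ∈ Finset.range n, (1 - a * q ^ k)

/-- The infinite q-shifted factorial `(a;q)_∞ = ∏_{k≥0} (1 - a q^k)`
(the product converges absolutely for `|q| < 1`). -/
def qPochInf (a q : ℝ) : ℝ := ∏' k : ℕ, (1 - a * q ^ k)

/-- The Jackson integral `∫_0^b φ(x) d_q x = (1-q) ∑_{n≥0} b q^n φ(b q^n)`. -/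
def jacksonTo (q b : ℝ) (φ : ℝ → ℝ) : ℝ :=
  (1 - q) * ∑' n : ℕ, b * q ^ n * φ (b * q ^ n)

/-- The Jackson integral `∫_0^∞ φ(x) d_q x = (1-q) ∑_{s∈ℤ} q^s φ(q^s)`. -/
def jacksonInfty (q : ℝ) (φ : ℝ → ℝ) : ℝ :=
  (1 - q) * ∑' s : ℤ, q ^ s * φ (q ^ s)

/-- Absolute convergence of `∫_0^∞ φ(x) d_q x`. -/
def JacksonIntegrable (q : ℝ) (φ : ℝ → ℝ) : Prop :=
  Summable fun s : ℤ => q ^ s * φ (q ^ s)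

/-- The q-Laguerre weight `ρ(x;q) = x^α / (-x;q)_∞`. -/
def laguerreWeight (α q x : ℝ) : ℝ := x ^ α / qPochInf (-x) q

/-- The monic q-Laguerre polynomial
`p_n^{(α)}(x;q) = (-1)^n q^{-n(n+α)} (q^{α+1};q)_n ₁φ₁(q^{-n}; q^{α+1}; q, -q^{n+α+1} x)`. -/
def qLaguerre (α q : ℝ) (n : ℕ) : ℝ[X] :=
  Polynomial.C ((-1) ^ n * q ^ (-((n : ℝ) * (n + α))) * qPoch (q ^ (α + 1)) q n) *
    ∑ k ∈ Finset.range (n + 1),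
      Polynomial.C (qPoch ((q ^ n)⁻¹) q k * q ^ (k.choose 2) * (q ^ ((n : ℝ) + α + 1)) ^ k /
        (qPoch (q ^ (α + 1)) q k * qPoch q q k)) * Polynomial.X ^ k

/-- The weight `ω(x;q) = q^{-(α+1)/8} x^{(α-1)/2} / (-x;q)_∞`. -/
def laguerreSkewWeight (α q x : ℝ) : ℝ :=
  q ^ (-(α + 1) / 8) * x ^ ((α - 1) / 2) / qPochInf (-x) q

/-- The integrand `(φ(x)ψ(y) - φ(y)ψ(x)) ω(x) ω(y)` of the skew inner product. -/
def skewIntegrand (ω : ℝ → ℝ) (φ ψ : ℝ[X]) (x y : ℝ) : ℝ :=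
  (φ.eval x * ψ.eval y - φ.eval y * ψ.eval x) * ω x * ω y

/-- The skew inner product
`⟨φ,ψ⟩_{1,ω} = ∫_0^∞ ∫_0^{q^{1/2} y} (φ(x)ψ(y) - φ(y)ψ(x)) ω(x) ω(y) d_q x d_q y`. -/
def skewInner (q : ℝ) (ω : ℝ → ℝ) (φ ψ : ℝ[X]) : ℝ :=
  jacksonInfty q fun y => jacksonTo q (√q * y) fun x => skewIntegrand ω φ ψ x y

/-- Absolute convergence of the double series defining `skewInner q ω φ ψ`
(with `y = q^s` and `x = q^{1/2} y q^n`). -/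
def SkewIntegrable (q : ℝ) (ω : ℝ → ℝ) (φ ψ : ℝ[X]) : Prop :=
  Summable fun t : ℤ × ℕ =>
    q ^ t.1 * (√q * q ^ t.1 * q ^ t.2) *
      skewIntegrand ω φ ψ (√q * q ^ t.1 * q ^ t.2) (q ^ t.1)

/-- `Q` is a family of monic skew orthogonal polynomials for `⟨·,·⟩_{1,ω}`. -/
structure IsSkewOrthogonalFamily (q : ℝ) (ω : ℝ → ℝ) (Q : ℕ → ℝ[X]) : Prop where
  monic : ∀ n, (Q n).Monic
  natDegree_eq : ∀ n, (Q n).natDegree = n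
  even_even : ∀ m n, skewInner q ω (Q (2 * m)) (Q (2 * n)) = 0
  odd_odd : ∀ m n, skewInner q ω (Q (2 * m + 1)) (Q (2 * n + 1)) = 0
  even_odd : ∀ m n, m ≠ n → skewInner q ω (Q (2 * m)) (Q (2 * n + 1)) = 0
  norm_ne_zero : ∀ n, skewInner q ω (Q (2 * n)) (Q (2 * n + 1)) ≠ 0

/-- The coefficient `q^{-4n-α} (1 - q^n) (1 - q^{n+α/2})`; it vanishes for `n = 0`. -/
def skewCoeff (α q : ℝ) (n : ℕ) : ℝ :=
  q ^ (-(4 * (n : ℝ)) - α) * (1 - q ^ n) * (1 - q ^ ((n : ℝ) + α / 2))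

/-- Index set of the ordered `N`-fold Jackson integral over `(0,∞)`. -/
abbrev OrderedIndex (N : ℕ) : Type := {κ : Fin N → ℤ // Monotone κ}

/-- The configuration point indexed by `κ`. With zero-based indices its coordinates are
`z_i = q^{κ_i + i/2}`; since `κ` ranges over the nondecreasing integer sequences, `z_0` ranges over
`q^ℤ` and, given `z_{i-1}`, the next coordinate `z_i` ranges over `{q^{m+1/2} z_{i-1} : m ≥ 0}`,
the lattice of `∫_0^{q^{1/2} z_{i-1}} d_q z_i`. -/
def orderedPoint (q : ℝ) {N : ℕ} (κ : OrderedIndex N) (i : Fin N) : ℝ :=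
  q ^ (κ.1 i) * √q ^ (i : ℕ)

/-- The terms of the series defining the ordered `N`-fold Jackson integral. -/
def orderedTerm (q : ℝ) (N : ℕ) (F : (Fin N → ℝ) → ℝ) (κ : OrderedIndex N) : ℝ :=
  (∏ i, orderedPoint q κ i) * F (orderedPoint q κ)

/-- The ordered Jackson integral
`∫_{z_1=0}^∞ ∫_{z_2=0}^{q^{1/2} z_1} ⋯ ∫_{z_N=0}^{q^{1/2} z_{N-1}} F(z) d_q z_1 ⋯ d_q z_N`. -/
def orderedJackson (q : ℝ) (N : ℕ) (F : (Fin N → ℝ) → ℝ) : ℝ :=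
  (1 - q) ^ N * ∑' κ : OrderedIndex N, orderedTerm q N F κ

/-- The integrand `∏_{j<k} (z_j - z_k) ∏_i z_i^{(α-1)/2} / (-z_i;q)_∞`. -/
def laguerreEnsembleIntegrand (α q : ℝ) (N : ℕ) (z : Fin N → ℝ) : ℝ :=
  (∏ j : Fin N, ∏ k ∈ Finset.Ioi j, (z j - z k)) *
    ∏ i : Fin N, (z i) ^ ((α - 1) / 2) / qPochInf (-(z i)) q

end

section

open Filter Topology

noncomputable section

/-! Put p = √q. In ⟨φ,ψ⟩ the outer variable runs over p^{2ℤ} and the inner one over the smaller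
points of p·p^{2ℤ}, so the form lives on p^ℤ, the lattice of the base-p q-Laguerre weight ρ. With
m(x) = xω(x) one has m(p²x) = p^{α+1}(1+x)m(x) and m(x)m(px) = xρ(x;p). By the first identity, for
Df(x) = f(x/p) − p^{α+1}(1+x)f(px) the product (Df)·m is a difference along each sublattice. The
inner sums of ⟨f,Dg⟩ therefore telescope, and by the second identity ⟨f,Dg⟩ is a negative constant
times ∫fgρ d_p x (`laguerreSkewForm_laguerreD`).

D is skew-symmetric for ρ and raises the degree by at most one, so D p_n involves only p_{n+1} and
p_{n-1} (`laguerreD_qLaguerre_succ`). The ratio of norms shows that D p_{2n} is a multiple of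
Q_{2n+1}. Pairing with Q_{2n+1} is thus integration against p_{2n}, which settles the even-odd and
odd-odd products; the even-even ones vanish by induction from ⟨p_{2m}, D p_{2n+1}⟩ = 0. Uniqueness
is nondegeneracy of the form on polynomials of degree < 2n (`IsSkewOrthogonalFamily.iff_exists`),
and (3) inverts a bidiagonal system.

Orthogonality of the p_n comes from the moments, which satisfy a two-term recursion by a shift of
the lattice, and from the terminating q-binomial theorem. The total mass is a ₁ψ₁ sum, obtained as a
limit of q-binomial series.

For (4), the integrand is, up to a constant, the determinant of the values of the Q_k times m at the
z_i. The sum of this determinant over n unconstrained pairs (e_i ≤ o_i) is a Pfaffian sum, block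
diagonal by skew orthogonality. Sorting the pairs accounts for n!, and a sign-reversing exchange of
second entries cancels every configuration that is not interlacing, e_1 ≤ o_1 < e_2 ≤ o_2 < ⋯
(`tsum_separated_det_eq_prod`). -/

theorem qPoch_zero (a q : ℝ) : qPoch a q 0 = 1 := by simp [qPoch]

theorem qPoch_succ (a q : ℝ) (n : ℕ) : qPoch a q (n + 1) = qPoch a q n * (1 - a * q ^ n) := by
  simp [qPoch, Finset.prod_range_succ]

theorem qPoch_add (a q : ℝ) (m n : ℕ) :
    qPoch a q (m + n) = qPoch a q m * qPoch (a * q ^ m) q n := by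
  simp [qPoch, Finset.prod_range_add, pow_add, mul_assoc]

theorem qPoch_succ' (a q : ℝ) (n : ℕ) : qPoch a q (n + 1) = (1 - a) * qPoch (a * q) q n := by
  rw [add_comm, qPoch_add]; simp [qPoch]

/-! ### Infinite q-shifted factorials -/

section QPochInf

variable {q : ℝ}

theorem qPoch_pos (hq0 : 0 < q) (hq1 : q < 1) {a : ℝ} (ha : a < 1) (n : ℕ) : 0 < qPoch a q n := by
  refine Finset.prod_pos fun k _ => ?_
  have h1 : q ^ k ≤ 1 := pow_le_one₀ hq0.le hq1.le
  have h0 : 0 < q ^ k := pow_pos hq0 k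
  rcases le_or_gt a 0 with h | h
  · nlinarith
  · nlinarith

theorem summable_norm_mul_pow (hq0 : 0 < q) (hq1 : q < 1) (a : ℝ) :
    Summable fun k : ℕ => ‖-(a * q ^ k)‖ := by
  simp only [norm_neg, norm_mul, norm_pow]
  exact (summable_geometric_of_lt_one (norm_nonneg q)
    (by rwa [Real.norm_of_nonneg hq0.le])).mul_left _

theorem multipliable_qPochInf (hq0 : 0 < q) (hq1 : q < 1) (a : ℝ) :
    Multipliable fun k : ℕ => 1 - a * q ^ k := by
  simpa only [sub_eq_add_neg] using
    multipliable_one_add_of_summable (summable_norm_mul_pow hq0 hq1 a)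

theorem tendsto_qPoch (hq0 : 0 < q) (hq1 : q < 1) (a : ℝ) :
    Tendsto (qPoch a q) atTop (𝓝 (qPochInf a q)) :=
  (multipliable_qPochInf hq0 hq1 a).tendsto_prod_tprod_nat

theorem qPochInf_eq_qPoch_mul (hq0 : 0 < q) (hq1 : q < 1) (a : ℝ) (n : ℕ) :
    qPochInf a q = qPoch a q n * qPochInf (a * q ^ n) q := by
  have h1 := (tendsto_qPoch hq0 hq1 (a * q ^ n)).const_mul (qPoch a q n)
  simp only [← qPoch_add] at h1
  refine tendsto_nhds_unique (tendsto_qPoch hq0 hq1 a) ?_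
  rw [← tendsto_add_atTop_iff_nat n]
  simpa only [add_comm] using h1

theorem qPochInf_eq_mul (hq0 : 0 < q) (hq1 : q < 1) (a : ℝ) :
    qPochInf a q = (1 - a) * qPochInf (a * q) q := by
  simpa [qPoch] using qPochInf_eq_qPoch_mul hq0 hq1 a 1

/-- The limit of positive partial products is only known to be nonnegative; it is nonzero because no
factor vanishes and the product converges absolutely. -/
theorem qPochInf_pos (hq0 : 0 < q) (hq1 : q < 1) {a : ℝ} (ha : a < 1) : 0 < qPochInf a q := by
  refine lt_of_le_of_ne (ge_of_tendsto' (tendsto_qPoch hq0 hq1 a)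
    fun n => (qPoch_pos hq0 hq1 ha n).le) (Ne.symm ?_)
  have := tprod_one_add_ne_zero_of_summable (f := fun k : ℕ => -(a * q ^ k)) (fun k => ?_)
    (summable_norm_mul_pow hq0 hq1 a)
  · simpa only [qPochInf, sub_eq_add_neg] using this
  have := (mul_pos_iff_of_pos_left (qPoch_pos hq0 hq1 ha k)).1
    ((qPoch_succ a q k).symm ▸ qPoch_pos hq0 hq1 ha (k + 1))
  rw [← sub_eq_add_neg]; exact this.ne'

theorem qPochInf_antitone (hq0 : 0 < q) (hq1 : q < 1) {a : ℝ} (ha0 : 0 ≤ a) (ha : a < 1) (n : ℕ) :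
    qPochInf a q ≤ qPoch a q n := by
  refine (antitone_nat_of_succ_le fun n => ?_).le_of_tendsto (tendsto_qPoch hq0 hq1 a) n
  rw [qPoch_succ]
  have := qPoch_pos hq0 hq1 ha n
  have : 0 ≤ a * q ^ n := by positivity
  nlinarith

end QPochInf

/-! ### The q-binomial theorem, infinite and terminating -/

section QBinomial

variable {q : ℝ}

theorem exists_bound_qPoch_div (hq0 : 0 < q) (hq1 : q < 1) (a : ℝ) :
    ∃ M, ∀ j, ‖qPoch a q j / qPoch q q j‖ ≤ M := by
  have h := ((tendsto_qPoch hq0 hq1 a).div (tendsto_qPoch hq0 hq1 q) (qPochInf_pos hq0 hq1 hq1).ne')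
  obtain ⟨M, hM⟩ := (Metric.isBounded_range_of_tendsto _ h).exists_norm_le
  exact ⟨M, fun j => hM _ ⟨j, rfl⟩⟩

theorem summable_qBinomial (hq0 : 0 < q) (hq1 : q < 1) (a : ℝ) {w : ℝ} (hw : ‖w‖ < 1) :
    Summable fun j => qPoch a q j / qPoch q q j * w ^ j := by
  obtain ⟨M, hM⟩ := exists_bound_qPoch_div hq0 hq1 a
  refine Summable.of_norm_bounded
    ((summable_geometric_of_lt_one (norm_nonneg w) hw).mul_left M) fun j => ?_
  rw [norm_mul, norm_pow]
  gcongr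
  exact hM j

/-- Functional equation of the `q`-binomial series. -/
theorem qBinomial_functional_equation (hq0 : 0 < q) (hq1 : q < 1) (a : ℝ) {w : ℝ} (hw : ‖w‖ < 1) :
    (∑' j, qPoch a q j / qPoch q q j * w ^ j) * (1 - w) =
      (1 - a * w) * ∑' j, qPoch a q j / qPoch q q j * (w * q) ^ j := by
  have hwq : ‖w * q‖ < 1 := by
    rw [norm_mul, Real.norm_of_nonneg hq0.le]
    nlinarith [norm_nonneg w]
  have s1 := summable_qBinomial hq0 hq1 a hw
  have s2 := summable_qBinomial hq0 hq1 a hwq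
  -- The difference multiplies the j-th coefficient by 1 − q^j, which cancels the last factor of
  -- (q;q)_j and shifts the index by one.
  have key : (∑' j, qPoch a q j / qPoch q q j * w ^ j) -
      (∑' j, qPoch a q j / qPoch q q j * (w * q) ^ j) =
      w * ((∑' j, qPoch a q j / qPoch q q j * w ^ j) -
        a * ∑' j, qPoch a q j / qPoch q q j * (w * q) ^ j) := by
    rw [← s1.tsum_sub s2, ← tsum_mul_left, ← s1.tsum_sub (s2.mul_left a), ← tsum_mul_left,
      (s1.sub s2).tsum_eq_zero_add]
    simp only [pow_zero, sub_self, zero_add]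
    refine tsum_congr fun j => ?_
    have h1 := (qPoch_pos hq0 hq1 hq1 j).ne'
    have h2 := (qPoch_pos hq0 hq1 hq1 (j + 1)).ne'
    rw [qPoch_succ] at h2
    have h3 := right_ne_zero_of_mul h2
    rw [qPoch_succ, qPoch_succ, pow_succ, pow_succ, mul_pow]
    generalize q ^ j = X at *
    calc _ = qPoch a q j * (1 - a * X) / (qPoch q q j * (1 - q * X)) * (w ^ j * w) *
          (1 - q * X) := by ring
      _ = qPoch a q j * (1 - a * X) / qPoch q q j * (w ^ j * w) := by
        generalize 1 - q * X = Z at *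
        field_simp
      _ = _ := by ring
  linear_combination key

/-- The `q`-binomial theorem. -/
theorem qBinomial_theorem (hq0 : 0 < q) (hq1 : q < 1) (a : ℝ) {w : ℝ} (hw : ‖w‖ < 1) :
    (∑' j, qPoch a q j / qPoch q q j * w ^ j) * qPochInf w q = qPochInf (a * w) q := by
  have hwn : ∀ n, ‖w * q ^ n‖ ≤ ‖w‖ := fun n => by
    rw [norm_mul, norm_pow, Real.norm_of_nonneg hq0.le]
    exact mul_le_of_le_one_right (norm_nonneg w) (pow_le_one₀ hq0.le hq1.le)
  have iter : ∀ n, (∑' j, qPoch a q j / qPoch q q j * w ^ j) * qPoch w q n =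
      qPoch (a * w) q n * ∑' j, qPoch a q j / qPoch q q j * (w * q ^ n) ^ j := by
    intro n
    induction n with
    | zero => simp [qPoch_zero]
    | succ n ih =>
      have := qBinomial_functional_equation hq0 hq1 a ((hwn n).trans_lt hw)
      rw [qPoch_succ, ← mul_assoc, ih, qPoch_succ, mul_assoc, this]
      simp only [pow_succ, mul_assoc]
  obtain ⟨M, hM⟩ := exists_bound_qPoch_div hq0 hq1 a
  -- Iterating the functional equation pushes the argument to 0, where only the term j = 0 survives.
  have lim : Tendsto (fun n : ℕ => ∑' j, qPoch a q j / qPoch q q j * (w * q ^ n) ^ j) atTop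
      (𝓝 (∑' j, qPoch a q j / qPoch q q j * 0 ^ j)) := by
    refine tendsto_tsum_of_dominated_convergence
      ((summable_geometric_of_lt_one (norm_nonneg w) hw).mul_left M) (fun j => ?_)
      (Eventually.of_forall fun n j => ?_)
    · refine Tendsto.const_mul _ (Tendsto.pow ?_ j)
      simpa using (tendsto_pow_atTop_nhds_zero_of_lt_one hq0.le hq1).const_mul w
    · rw [norm_mul, norm_pow]
      exact mul_le_mul (hM j) (pow_le_pow_left₀ (norm_nonneg _) (hwn n) j) (by positivity)
        ((norm_nonneg _).trans (hM j))
  rw [tsum_eq_single 0 (fun j hj => by simp [hj])] at lim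
  have l1 := (tendsto_qPoch hq0 hq1 w).const_mul (∑' j, qPoch a q j / qPoch q q j * w ^ j)
  simp only [iter] at l1
  refine tendsto_nhds_unique l1 ?_
  simpa [qPoch_zero] using (tendsto_qPoch hq0 hq1 (a * w)).mul lim

/-- The terminating `q`-binomial theorem. -/
theorem sum_qPoch_inv_pow (hq0 : 0 < q) (hq1 : q < 1) (n : ℕ) (w : ℝ) :
    ∑ k ∈ Finset.range (n + 1), qPoch ((q ^ n)⁻¹) q k / qPoch q q k * w ^ k =
      qPoch (w * (q ^ n)⁻¹) q n := by
  induction n with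
  | zero => simp [qPoch]
  | succ n ih =>
    -- A q-Pascal rule for the coefficients, which turns the sum for n + 1 into (1 − w q^{-n-1})
    -- times the sum for n.
    have hrec : ∀ k, qPoch ((q ^ (n + 1))⁻¹) q (k + 1) / qPoch q q (k + 1) =
        qPoch ((q ^ n)⁻¹) q (k + 1) / qPoch q q (k + 1) -
          (q ^ (n + 1))⁻¹ * (qPoch ((q ^ n)⁻¹) q k / qPoch q q k) := by
      intro k
      have h1 := (qPoch_pos hq0 hq1 hq1 k).ne'
      have h2 := (qPoch_pos hq0 hq1 hq1 (k + 1)).ne'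
      rw [qPoch_succ] at h2
      have h3 := right_ne_zero_of_mul h2
      have h4 : (q ^ (n + 1))⁻¹ * q = (q ^ n)⁻¹ := by
        rw [pow_succ]; field_simp
      rw [qPoch_succ', h4, qPoch_succ, qPoch_succ, ← h4]
      generalize (q ^ (n + 1))⁻¹ = Y at *
      generalize q ^ k = X at *
      field_simp
      ring
    have hz : qPoch ((q ^ n)⁻¹) q (n + 1) = 0 := by
      rw [qPoch_succ, inv_mul_cancel₀ (pow_pos hq0 n).ne', sub_self, mul_zero]
    have h4 : w * (q ^ (n + 1))⁻¹ * q = w * (q ^ n)⁻¹ := by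
      rw [pow_succ]; field_simp
    have hsplit : ∑ k ∈ Finset.range (n + 1 + 1),
        qPoch ((q ^ n)⁻¹) q k / qPoch q q k * w ^ k = qPoch (w * (q ^ n)⁻¹) q n := by
      rw [Finset.sum_range_succ, hz, ih]; simp
    rw [Finset.sum_range_succ'] at hsplit
    rw [Finset.sum_range_succ', qPoch_succ', h4, ← ih]
    simp only [hrec, sub_mul, Finset.sum_sub_distrib]
    have hM : ∑ k ∈ Finset.range (n + 1), (q ^ (n + 1))⁻¹ *
        (qPoch ((q ^ n)⁻¹) q k / qPoch q q k) * w ^ (k + 1) =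
        w * (q ^ (n + 1))⁻¹ * qPoch (w * (q ^ n)⁻¹) q n := by
      rw [← ih, Finset.mul_sum]
      refine Finset.sum_congr rfl fun k _ => ?_
      rw [pow_succ]
      ring
    rw [hM, ih]
    simp only [qPoch_zero] at hsplit ⊢
    linear_combination hsplit

end QBinomial

/-! ### Bilateral series and the total mass -/

section Bilateral

variable {q : ℝ}

theorem qPochInf_neg_mul_zpow (hq0 : 0 < q) (hq1 : q < 1) (y : ℝ) (k : ℤ) :
    qPochInf (-(y * q ^ k)) q = (1 + y * q ^ k) * qPochInf (-(y * q ^ (k + 1))) q := by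
  rw [qPochInf_eq_mul hq0 hq1, sub_neg_eq_add, zpow_add_one₀ hq0.ne', neg_mul, mul_assoc]

theorem qPochInf_neg_pos (hq0 : 0 < q) (hq1 : q < 1) {x : ℝ} (hx : 0 < x) :
    0 < qPochInf (-x) q :=
  qPochInf_pos hq0 hq1 (by linarith)

theorem one_le_qPochInf_neg (hq0 : 0 < q) (hq1 : q < 1) {x : ℝ} (hx : 0 < x) :
    1 ≤ qPochInf (-x) q := by
  refine ge_of_tendsto' (tendsto_qPoch hq0 hq1 (-x)) fun n => ?_
  unfold qPoch
  refine Finset.prod_induction _ (fun r : ℝ => 1 ≤ r) (fun a b ha hb => one_le_mul_of_one_le_of_one_le ha hb)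
    le_rfl fun k _ => ?_
  have : 0 < x * q ^ k := by positivity
  linarith

/-- Towards +∞ the reciprocal is at most 1 and t^k is geometric. Towards −∞ each step gains a factor
1 + y q^{-n-1}, whose growth beats the constant ratio t⁻¹. -/
theorem summable_zpow_mul_qPochInf_inv (hq0 : 0 < q) (hq1 : q < 1) {y t : ℝ} (hy : 0 < y)
    (ht0 : 0 < t) (ht1 : t < 1) :
    Summable fun k : ℤ => t ^ k * (qPochInf (-(y * q ^ k)) q)⁻¹ := by
  have hpos : ∀ k : ℤ, 0 < qPochInf (-(y * q ^ k)) q := fun k =>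
    qPochInf_neg_pos hq0 hq1 (mul_pos hy (zpow_pos hq0 k))
  refine Summable.of_nat_of_neg ?_ ?_
  · refine Summable.of_nonneg_of_le (fun n => ?_) (fun n => ?_)
      (summable_geometric_of_lt_one ht0.le ht1)
    · exact mul_nonneg (zpow_pos ht0 _).le (inv_nonneg.2 (hpos _).le)
    · rw [zpow_natCast]
      refine mul_le_of_le_one_right (pow_pos ht0 n).le (inv_le_one_of_one_le₀ ?_)
      exact one_le_qPochInf_neg hq0 hq1 (mul_pos hy (zpow_pos hq0 _))
  · refine summable_of_ratio_test_tendsto_lt_one (l := 0) one_pos (Eventually.of_forall fun n =>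
      (mul_pos (zpow_pos ht0 _) (inv_pos.2 (hpos _))).ne') ?_
    have hr : ∀ n : ℕ, ‖t ^ (-((n + 1 : ℕ) : ℤ)) * (qPochInf (-(y * q ^ (-((n + 1 : ℕ) : ℤ)))) q)⁻¹‖ /
        ‖t ^ (-(n : ℤ)) * (qPochInf (-(y * q ^ (-(n : ℤ)))) q)⁻¹‖ =
        t⁻¹ * (1 + y * (q⁻¹) ^ (n + 1))⁻¹ := by
      intro n
      have h1 := hpos (-(n : ℤ))
      have h2 := qPochInf_neg_mul_zpow hq0 hq1 y (-((n + 1 : ℕ) : ℤ))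
      have h3 : -((n + 1 : ℕ) : ℤ) + 1 = -(n : ℤ) := by push_cast; ring
      rw [h3] at h2
      have h4 : q ^ (-((n + 1 : ℕ) : ℤ)) = (q⁻¹) ^ (n + 1) := by
        rw [zpow_neg, zpow_natCast, inv_pow]
      have h5 : t ^ (-((n + 1 : ℕ) : ℤ)) = t⁻¹ * t ^ (-(n : ℤ)) := by
        rw [← zpow_neg_one, ← zpow_add₀ ht0.ne']; congr 1; push_cast; ring
      have h6 : 0 < 1 + y * (q⁻¹) ^ (n + 1) := by positivity
      have h7 : 0 < t ^ (-(n : ℤ)) := zpow_pos ht0 _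
      rw [h2, h4, h5, Real.norm_of_nonneg (by positivity), Real.norm_of_nonneg (by positivity)]
      field_simp
    rw [tendsto_congr hr]
    rw [show (0 : ℝ) = t⁻¹ * 0 by simp]
    refine Tendsto.const_mul _ (tendsto_inv_atTop_zero.comp ?_)
    refine tendsto_atTop_add_const_left _ _ (Tendsto.const_mul_atTop hy ?_)
    exact (tendsto_pow_atTop_atTop_of_one_lt ((one_lt_inv₀ hq0).2 hq1)).comp (tendsto_add_atTop_nat 1)

/-- The first N factors of (−wq^{-N};q)_∞, read backwards, are w^N q^{-N(N+1)/2} (−q/w;q)_N; the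
power of q cancels against the same expression at w = 1. -/
theorem qPochInf_neg_zpow_div (hq0 : 0 < q) (hq1 : q < 1) {w : ℝ} (hw : 0 < w) (N : ℕ) :
    (w ^ N)⁻¹ * qPochInf (-(w * q ^ (-(N : ℤ)))) q / qPochInf (-(1 * q ^ (-(N : ℤ)))) q =
      qPochInf (-w) q * qPoch (-(q / w)) q N / (qPochInf (-1) q * qPoch (-q) q N) := by
  induction N with
  | zero => simp [qPoch_zero]
  | succ N ih =>
    have h0 : ∀ x : ℝ, 0 < x → 0 < qPochInf (-(x * q ^ (-(N : ℤ)))) q := fun x hx =>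
      qPochInf_neg_pos hq0 hq1 (by positivity)
    have h1 := h0 1 one_pos
    have h2 : ∀ x : ℝ, qPochInf (-(x * q ^ (-((N + 1 : ℕ) : ℤ)))) q =
        (1 + x * (q ^ (N + 1))⁻¹) * qPochInf (-(x * q ^ (-(N : ℤ)))) q := fun x => by
      have h3 : -((N + 1 : ℕ) : ℤ) + 1 = -(N : ℤ) := by push_cast; ring
      rw [qPochInf_neg_mul_zpow hq0 hq1, h3, zpow_neg, zpow_natCast]
    have h4 : 0 < qPochInf (-1) q := qPochInf_neg_pos hq0 hq1 one_pos
    have h5 : 0 < qPoch (-q) q N := qPoch_pos hq0 hq1 (by linarith) N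
    rw [h2, h2, qPoch_succ, qPoch_succ]
    have h6 : 0 < q ^ N := pow_pos hq0 N
    have h7 : 1 - -q * q ^ N ≠ 0 := by nlinarith
    have h8 : 1 + 1 * (q ^ (N + 1))⁻¹ ≠ 0 := by positivity
    calc _ = ((w ^ N)⁻¹ * qPochInf (-(w * q ^ (-(N : ℤ)))) q /
            qPochInf (-(1 * q ^ (-(N : ℤ)))) q) *
          (w⁻¹ * (1 + w * (q ^ (N + 1))⁻¹) / (1 + 1 * (q ^ (N + 1))⁻¹)) := by
          rw [pow_succ]; field_simp
      _ = (qPochInf (-w) q * qPoch (-(q / w)) q N / (qPochInf (-1) q * qPoch (-q) q N)) *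
          ((1 - -(q / w) * q ^ N) / (1 - -q * q ^ N)) := by
          rw [ih]
          congr 1
          rw [div_eq_div_iff h8 h7, pow_succ]
          field_simp
          ring
      _ = _ := by rw [div_mul_div_comm]; ring

/-- A special case of Ramanujan's `₁ψ₁` summation. -/
theorem tsum_zpow_mul_qPochInf_inv (hq0 : 0 < q) (hq1 : q < 1) {w : ℝ} (hw0 : 0 < w)
    (hw1 : w < 1) :
    ∑' k : ℤ, w ^ k * (qPochInf (-(q ^ k)) q)⁻¹ =
      qPochInf q q * qPochInf (-w) q * qPochInf (-(q / w)) q /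
        (2 * qPochInf (-q) q * qPochInf (-q) q * qPochInf w q) := by
  have hs := summable_zpow_mul_qPochInf_inv hq0 hq1 one_pos hw0 hw1
  simp only [one_mul] at hs
  have hc : ∀ k : ℤ, 0 < qPochInf (-(q ^ k)) q := fun k =>
    qPochInf_neg_pos hq0 hq1 (zpow_pos hq0 k)
  have hqq := qPochInf_pos hq0 hq1 hq1
  have hw := qPochInf_pos hq0 hq1 hw1
  -- The summand cut off at k ≥ −N and divided by (q;q)_{k+N}. With j = k + N it is a q-binomial
  -- series with parameter −q^{-N}, and as N → ∞ the divisor tends to (q;q)_∞.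
  let F : ℕ → ℤ → ℝ := fun N k =>
    if -(N : ℤ) ≤ k then w ^ k * (qPochInf (-(q ^ k)) q)⁻¹ / qPoch q q (k + N).toNat else 0
  have hF : ∀ N, ∑' k, F N k = qPochInf (-w) q * qPoch (-(q / w)) q N /
      (qPochInf (-1) q * qPoch (-q) q N) / qPochInf w q := by
    intro N
    have hinj : Function.Injective fun j : ℕ => (j : ℤ) - N := fun a b h => by simpa using h
    rw [← hinj.tsum_eq, ← qPochInf_neg_zpow_div hq0 hq1 hw0, eq_div_iff hw.ne']
    · have hb := qBinomial_theorem hq0 hq1 (-(q ^ (-(N : ℤ))))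
        (w := w) (by rwa [Real.norm_of_nonneg hw0.le])
      rw [neg_mul, mul_comm (q ^ (-(N : ℤ))) w] at hb
      rw [← hb, one_mul, mul_div_assoc, mul_div_right_comm, ← tsum_div_const, ← mul_assoc,
        ← tsum_mul_left]
      congr 1
      refine tsum_congr fun j => ?_
      have hj : -(N : ℤ) ≤ (j : ℤ) - N := by omega
      have hj2 : ((j : ℤ) - N + N).toNat = j := by simp
      have h1 := qPochInf_eq_qPoch_mul hq0 hq1 (-(q ^ (-(N : ℤ)))) j
      rw [neg_mul, ← zpow_natCast q j, ← zpow_add₀ hq0.ne', show -(N : ℤ) + j = j - N by ring] at h1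
      have h2 := (hc (j - N)).ne'
      have h3 := (hc (-N)).ne'
      have h4 := (qPoch_pos hq0 hq1 hq1 j).ne'
      simp only [F, if_pos hj, hj2]
      rw [zpow_sub₀ hw0.ne', zpow_natCast, zpow_natCast, h1]
      rw [h1] at h3
      have h5 := left_ne_zero_of_mul h3
      field_simp
    · intro k hk
      by_cases h : -(N : ℤ) ≤ k
      · exact ⟨(k + N).toNat, by simp; omega⟩
      · simp [F, h] at hk
  have lim : Tendsto (fun N => ∑' k, F N k) atTop
      (𝓝 (∑' k : ℤ, w ^ k * (qPochInf (-(q ^ k)) q)⁻¹ / qPochInf q q)) := by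
    refine tendsto_tsum_of_dominated_convergence (hs.div_const (qPochInf q q)) (fun k => ?_)
      (Eventually.of_forall fun N k => ?_)
    · have h1 : Tendsto (fun N : ℕ => (k + N).toNat) atTop atTop := by
        refine tendsto_atTop_mono (f := fun N : ℕ => N - k.natAbs) (fun N => by omega) ?_
        exact tendsto_sub_atTop_nat _
      refine Tendsto.congr' ?_ (Tendsto.div tendsto_const_nhds
        ((tendsto_qPoch hq0 hq1 q).comp h1) hqq.ne')
      filter_upwards [eventually_ge_atTop k.natAbs] with N hN
      simp only [F]
      rw [if_pos (by omega)]
      rfl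
    · have h1 : 0 < w ^ k * (qPochInf (-(q ^ k)) q)⁻¹ :=
        mul_pos (zpow_pos hw0 k) (inv_pos.2 (hc k))
      by_cases h : -(N : ℤ) ≤ k
      · have h2 := qPoch_pos hq0 hq1 hq1 (k + N).toNat
        simp only [F, if_pos h]
        rw [Real.norm_of_nonneg (by positivity)]
        gcongr
        -- The partial products of (q;q)_∞ decrease to it, so dividing by the full product dominates
        -- uniformly in N.
        exact qPochInf_antitone hq0 hq1 hq0.le hq1 _
      · simp only [F, if_neg h, norm_zero]
        positivity
  simp only [hF] at lim
  rw [tsum_div_const] at lim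
  have hq' := qPochInf_neg_pos hq0 hq1 hq0
  have h1 := qPochInf_neg_pos hq0 hq1 one_pos
  have lim2 := ((((tendsto_qPoch hq0 hq1 (-(q / w))).const_mul (qPochInf (-w) q)).div
    ((tendsto_qPoch hq0 hq1 (-q)).const_mul (qPochInf (-1) q)) (by positivity)).div_const
      (qPochInf w q))
  have e := tendsto_nhds_unique lim lim2
  have h2 : qPochInf (-1) q = 2 * qPochInf (-q) q := by
    rw [qPochInf_eq_mul hq0 hq1]; norm_num
  rw [div_eq_iff hqq.ne', h2] at e
  rw [e]
  field_simp

end Bilateral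

/-! ### Polynomials expanded in a monic family -/

section MonicFamily

variable {R : ℕ → ℝ[X]}

theorem degree_sub_C_coeff_mul_lt {P f : ℝ[X]} {n : ℕ} (hP : P.Monic) (hPn : P.natDegree = n)
    (hf : f.degree < (n + 1 : ℕ)) : (f - Polynomial.C (f.coeff n) * P).degree < n := by
  rw [Polynomial.degree_lt_iff_coeff_zero] at hf ⊢
  intro m hm
  rw [Polynomial.coeff_sub, Polynomial.coeff_C_mul]
  rcases hm.eq_or_lt with rfl | h
  · rw [← hPn, hP.coeff_natDegree, mul_one, sub_self]
  · rw [hf m h, Polynomial.coeff_eq_zero_of_natDegree_lt (p := P) (by omega), mul_zero, sub_zero]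

/-- Peeling off leading coefficients shows that R_0, …, R_{n-1} span the polynomials of degree < n.
-/
theorem linearMap_eq_zero_of_degree_lt (hR : ∀ n, (R n).Monic) (hRn : ∀ n, (R n).natDegree = n)
    (l : ℝ[X] →ₗ[ℝ] ℝ) {n : ℕ} (h : ∀ j < n, l (R j) = 0) {f : ℝ[X]} (hf : f.degree < n) :
    l f = 0 := by
  induction n generalizing f with
  | zero =>
    rw [Polynomial.degree_lt_iff_coeff_zero] at hf
    rw [show f = 0 from Polynomial.ext fun m => by simpa using hf m (Nat.zero_le m), map_zero]
  | succ n ih =>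
    have h1 := ih (fun j hj => h j (by omega)) (degree_sub_C_coeff_mul_lt (hR n) (hRn n) hf)
    rwa [map_sub, ← Polynomial.smul_eq_C_mul, map_smul, h n (Nat.lt_succ_self n), smul_zero,
      sub_zero] at h1

end MonicFamily

/-! ### Moments, norms and orthogonality of the q-Laguerre polynomials -/

section QLaguerre

variable {q α : ℝ}

/-- Each factor 1 − q^{-j} equals −q^{-j}(1 − q^j), for j = 1, …, n, and the exponents j add up to
the binomial coefficient. -/
theorem qPoch_inv_pow_self (hq0 : 0 < q) (n : ℕ) :
    qPoch ((q ^ n)⁻¹) q n * q ^ ((n + 1).choose 2) = (-1) ^ n * qPoch q q n := by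
  induction n with
  | zero => simp [qPoch_zero]
  | succ n ih =>
    have h4 : (q ^ (n + 1))⁻¹ * q = (q ^ n)⁻¹ := by
      rw [pow_succ]; field_simp
    have h5 : (n + 1 + 1).choose 2 = (n + 1).choose 2 + (n + 1) := by
      rw [Nat.choose_succ_succ' (n + 1) 1]; simp [add_comm]
    rw [qPoch_succ', h4, h5, pow_add, qPoch_succ]
    have h6 : (q ^ (n + 1))⁻¹ * q ^ (n + 1) = 1 := inv_mul_cancel₀ (pow_pos hq0 _).ne'
    have h7 : q * q ^ n = q ^ (n + 1) := by ring
    rw [h7]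
    linear_combination (q ^ (n + 1) - 1) * ih - qPoch (q ^ n)⁻¹ q n * q ^ ((n + 1).choose 2) * h6

theorem qPoch_pow_mul_inv_pow (hq0 : 0 < q) {j n : ℕ} (hj : 1 ≤ j) (hjn : j ≤ n) :
    qPoch (q ^ j * (q ^ n)⁻¹) q n = 0 := by
  refine Finset.prod_eq_zero (i := n - j) (by simp; omega) ?_
  have : q ^ n = q ^ j * q ^ (n - j) := by rw [← pow_add]; congr 1; omega
  rw [this]
  have := pow_pos hq0 j
  have := pow_pos hq0 (n - j)
  field_simp
  simp

/-- The polynomial `X ↦ (zX;q)_m`. -/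
def qPochPoly (z q : ℝ) (m : ℕ) : ℝ[X] :=
  ∏ i ∈ Finset.range m, (1 - Polynomial.C (z * q ^ i) * Polynomial.X)

theorem eval_qPochPoly (z q x : ℝ) (m : ℕ) : (qPochPoly z q m).eval x = qPoch (z * x) q m := by
  simp [qPochPoly, qPoch, Polynomial.eval_prod, mul_right_comm]

theorem natDegree_qPochPoly_le (z q : ℝ) (m : ℕ) : (qPochPoly z q m).natDegree ≤ m := by
  refine (Polynomial.natDegree_prod_le _ _).trans ?_
  refine (Finset.sum_le_card_nsmul _ _ 1 fun i _ => ?_).trans (by simp)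
  compute_degree

theorem coeff_zero_qPochPoly (z q : ℝ) (m : ℕ) : (qPochPoly z q m).coeff 0 = 1 := by
  simp [Polynomial.coeff_zero_eq_eval_zero, eval_qPochPoly, qPoch]

/-- (zq^k;q)_m is a polynomial in q^k, and by the terminating q-binomial theorem its i-th monomial
contributes a multiple of (q^{i-m};q)_n. This vanishes for 1 ≤ n − m + i ≤ n, so only i = 0 with m =
n survives. -/
theorem sum_qPoch_mul_qPoch (hq0 : 0 < q) (hq1 : q < 1) (z : ℝ) {m n : ℕ} (hmn : m ≤ n) :
    ∑ k ∈ Finset.range (n + 1), qPoch ((q ^ n)⁻¹) q k / qPoch q q k * (q ^ (n - m)) ^ k *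
      qPoch (z * q ^ k) q m = if m = n then qPoch ((q ^ n)⁻¹) q n else 0 := by
  have h : ∀ k, qPoch (z * q ^ k) q m =
      ∑ i ∈ Finset.range (m + 1), (qPochPoly z q m).coeff i * (q ^ k) ^ i := fun k => by
    rw [← eval_qPochPoly, Polynomial.eval_eq_sum_range' (Nat.lt_succ_of_le (natDegree_qPochPoly_le z q m))]
  simp only [h, Finset.mul_sum]
  rw [Finset.sum_comm]
  have h2 : ∀ i, ∑ k ∈ Finset.range (n + 1), qPoch ((q ^ n)⁻¹) q k / qPoch q q k *
      (q ^ (n - m)) ^ k * ((qPochPoly z q m).coeff i * (q ^ k) ^ i) =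
      (qPochPoly z q m).coeff i * qPoch (q ^ (n - m + i) * (q ^ n)⁻¹) q n := fun i => by
    rw [← sum_qPoch_inv_pow hq0 hq1, Finset.mul_sum]
    refine Finset.sum_congr rfl fun k _ => ?_
    rw [pow_add, mul_pow, ← pow_mul q i k, mul_comm i k, pow_mul]
    ring
  simp only [h2]
  rw [Finset.sum_range_succ']
  have h3 : ∀ i ∈ Finset.range m, (qPochPoly z q m).coeff (i + 1) *
      qPoch (q ^ (n - m + (i + 1)) * (q ^ n)⁻¹) q n = 0 := fun i hi => by
    rw [Finset.mem_range] at hi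
    rw [qPoch_pow_mul_inv_pow hq0 (by omega) (by omega), mul_zero]
  rw [Finset.sum_eq_zero h3, coeff_zero_qPochPoly]
  split_ifs with hm
  · simp [hm]
  · rw [add_zero, qPoch_pow_mul_inv_pow hq0 (by omega) (by omega)]; simp

theorem rpow_add_one_lt_one (hq0 : 0 < q) (hq1 : q < 1) (hα : -1 < α) : q ^ (α + 1) < 1 :=
  Real.rpow_lt_one hq0.le hq1 (by linarith)

theorem zpow_mul_laguerreWeight (hq0 : 0 < q) (s : ℤ) :
    q ^ s * laguerreWeight α q (q ^ s) =
      (q ^ (α + 1)) ^ s * (qPochInf (-(q ^ s)) q)⁻¹ := by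
  unfold laguerreWeight
  have : q ^ s * (q ^ s) ^ α = (q ^ (α + 1)) ^ s := by
    rw [← Real.rpow_intCast, ← Real.rpow_intCast, ← Real.rpow_mul hq0.le, ← Real.rpow_mul hq0.le,
      ← Real.rpow_add hq0]
    congr 1; ring
  rw [← this]; ring

theorem summable_zpow_laguerre (hq0 : 0 < q) (hq1 : q < 1) (hα : -1 < α) (k : ℕ) :
    Summable fun s : ℤ => (q ^ s) ^ k * (q ^ s * laguerreWeight α q (q ^ s)) := by
  have hz := Real.rpow_pos_of_pos hq0 (α + 1)
  have hz1 := rpow_add_one_lt_one hq0 hq1 hα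
  have := summable_zpow_mul_qPochInf_inv hq0 hq1 one_pos
    (t := q ^ (α + 1) * q ^ k) (by positivity) (mul_lt_one_of_nonneg_of_lt_one_left hz.le hz1
      (pow_le_one₀ hq0.le hq1.le))
  refine this.congr fun s => ?_
  rw [zpow_mul_laguerreWeight hq0, one_mul, mul_zpow, ← zpow_natCast, ← zpow_natCast, zpow_comm]
  ring

theorem jacksonIntegrable_laguerre (hq0 : 0 < q) (hq1 : q < 1) (hα : -1 < α) (f : ℝ[X]) :
    JacksonIntegrable q fun x => f.eval x * laguerreWeight α q x := by
  unfold JacksonIntegrable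
  have := summable_sum (s := Finset.range (f.natDegree + 1)) fun k _ =>
    (summable_zpow_laguerre hq0 hq1 hα k).mul_left (f.coeff k)
  refine this.congr fun s => ?_
  simp only [Polynomial.eval_eq_sum_range (p := f), Finset.sum_mul, Finset.mul_sum]
  exact Finset.sum_congr rfl fun k _ => by ring

/-- Integration against the `q`-Laguerre weight, as a linear functional on polynomials. -/
def laguerreFunctional (hq0 : 0 < q) (hq1 : q < 1) (hα : -1 < α) : ℝ[X] →ₗ[ℝ] ℝ where
  toFun f := jacksonInfty q fun x => f.eval x * laguerreWeight α q x
  map_add' f g := by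
    have hf := jacksonIntegrable_laguerre hq0 hq1 hα f
    have hg := jacksonIntegrable_laguerre hq0 hq1 hα g
    unfold JacksonIntegrable at hf hg
    unfold jacksonInfty
    rw [← mul_add, ← hf.tsum_add hg]
    congr 1
    exact tsum_congr fun s => by simp only [Polynomial.eval_add]; ring
  map_smul' c f := by
    unfold jacksonInfty
    rw [RingHom.id_apply, smul_eq_mul, mul_left_comm]
    congr 1
    rw [← tsum_mul_left]
    exact tsum_congr fun s => by simp only [Polynomial.eval_smul, smul_eq_mul]; ring

theorem laguerreFunctional_apply (hq0 : 0 < q) (hq1 : q < 1) (hα : -1 < α) (f : ℝ[X]) :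
    laguerreFunctional hq0 hq1 hα f =
      (1 - q) * ∑' s : ℤ, f.eval (q ^ s) * (q ^ s * laguerreWeight α q (q ^ s)) := by
  simp only [laguerreFunctional, jacksonInfty, LinearMap.coe_mk, AddHom.coe_mk, mul_left_comm]

/-- The Pearson equation of the weight: one lattice step drops the factor 1 + q^s of the infinite
product. -/
theorem zpow_mul_laguerreWeight_succ (hq0 : 0 < q) (hq1 : q < 1) (s : ℤ) :
    q ^ (s + 1) * laguerreWeight α q (q ^ (s + 1)) =
      q ^ (α + 1) * (1 + q ^ s) * (q ^ s * laguerreWeight α q (q ^ s)) := by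
  have h1 := qPochInf_neg_mul_zpow hq0 hq1 1 s
  simp only [one_mul] at h1
  have h2 := qPochInf_neg_pos hq0 hq1 (zpow_pos hq0 (s + 1))
  have h3 : 0 < 1 + q ^ s := by have := zpow_pos hq0 s; positivity
  have h4 := Real.rpow_pos_of_pos hq0 (α + 1)
  rw [zpow_mul_laguerreWeight hq0, zpow_mul_laguerreWeight hq0, h1, zpow_add_one₀ h4.ne']
  field_simp

/-- Shift the bilateral sum by one step and apply the Pearson equation; its factor 1 + x brings in
the next moment. -/
theorem laguerreFunctional_X_pow_succ (hq0 : 0 < q) (hq1 : q < 1) (hα : -1 < α) (k : ℕ) :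
    laguerreFunctional hq0 hq1 hα (Polynomial.X ^ (k + 1)) * (q ^ (α + 1) * q ^ k) =
      laguerreFunctional hq0 hq1 hα (Polynomial.X ^ k) * (1 - q ^ (α + 1) * q ^ k) := by
  simp only [laguerreFunctional_apply, Polynomial.eval_pow, Polynomial.eval_X]
  have s1 := summable_zpow_laguerre hq0 hq1 hα k
  have s2 := summable_zpow_laguerre hq0 hq1 hα (k + 1)
  have h := (Equiv.addRight (1 : ℤ)).tsum_eq
    fun s : ℤ => (q ^ s) ^ k * (q ^ s * laguerreWeight α q (q ^ s))
  have h2 : ∑' s : ℤ, (q ^ (s + 1)) ^ k * (q ^ (s + 1) * laguerreWeight α q (q ^ (s + 1))) =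
      (q ^ (α + 1) * q ^ k) * (∑' s : ℤ, (q ^ s) ^ k * (q ^ s * laguerreWeight α q (q ^ s)) +
        ∑' s : ℤ, (q ^ s) ^ (k + 1) * (q ^ s * laguerreWeight α q (q ^ s))) := by
    rw [← s1.tsum_add s2, ← tsum_mul_left]
    refine tsum_congr fun s => ?_
    rw [zpow_mul_laguerreWeight_succ hq0 hq1, zpow_add_one₀ hq0.ne']
    ring
  simp only [Equiv.coe_addRight] at h
  rw [h] at h2
  linear_combination (-(1 - q)) * h2

theorem choose_two_succ (k : ℕ) : (k + 1).choose 2 = k.choose 2 + k := by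
  rw [Nat.choose_succ_succ' k 1]; simp [add_comm]

theorem choose_two_add (m k : ℕ) : (m + k).choose 2 = m.choose 2 + k.choose 2 + m * k := by
  induction k with
  | zero => simp
  | succ k ih => rw [← add_assoc, choose_two_succ, choose_two_succ, ih]; ring

theorem choose_two_add_succ (m : ℕ) : m.choose 2 + (m + 1).choose 2 = m ^ 2 := by
  induction m with
  | zero => rfl
  | succ m ih =>
    rw [choose_two_succ m] at ih
    rw [choose_two_succ (m + 1), choose_two_succ m]
    linear_combination ih

theorem laguerreFunctional_X_pow (hq0 : 0 < q) (hq1 : q < 1) (hα : -1 < α) (k : ℕ) :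
    laguerreFunctional hq0 hq1 hα (Polynomial.X ^ k) * ((q ^ (α + 1)) ^ k * q ^ (k.choose 2)) =
      laguerreFunctional hq0 hq1 hα 1 * qPoch (q ^ (α + 1)) q k := by
  induction k with
  | zero => simp [qPoch_zero]
  | succ k ih =>
    rw [qPoch_succ, choose_two_succ, pow_succ (q ^ (α + 1)), pow_add q]
    linear_combination (1 - q ^ (α + 1) * q ^ k) * ih +
      ((q ^ (α + 1)) ^ k * q ^ (k.choose 2)) * laguerreFunctional_X_pow_succ hq0 hq1 hα k

/-- The bilateral summation at w = q^{α+1}, where q/w = q^{-α}. -/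
theorem laguerreFunctional_one (hq0 : 0 < q) (hq1 : q < 1) (hα : -1 < α) :
    laguerreFunctional hq0 hq1 hα 1 = (1 - q) / 2 *
      (qPochInf q q * qPochInf (-(q ^ (α + 1))) q * qPochInf (-(q ^ (-α))) q) /
        (qPochInf (q ^ (α + 1)) q * qPochInf (-q) q * qPochInf (-q) q) := by
  have hz := Real.rpow_pos_of_pos hq0 (α + 1)
  have hz1 := rpow_add_one_lt_one hq0 hq1 hα
  have h1 : q / q ^ (α + 1) = q ^ (-α) := by
    nth_rewrite 1 [← Real.rpow_one q]
    rw [← Real.rpow_sub hq0]; congr 1; ring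
  rw [laguerreFunctional_apply]
  simp only [Polynomial.eval_one, one_mul, zpow_mul_laguerreWeight hq0]
  rw [tsum_zpow_mul_qPochInf_inv hq0 hq1 hz hz1, h1]
  have := qPochInf_pos hq0 hq1 hz1
  have := qPochInf_neg_pos hq0 hq1 hq0
  field_simp

theorem laguerreFunctional_one_pos (hq0 : 0 < q) (hq1 : q < 1) (hα : -1 < α) :
    0 < laguerreFunctional hq0 hq1 hα 1 := by
  have hz := Real.rpow_pos_of_pos hq0 (α + 1)
  have hz1 := rpow_add_one_lt_one hq0 hq1 hα
  rw [laguerreFunctional_one]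
  have := qPochInf_pos hq0 hq1 hz1
  have := qPochInf_pos hq0 hq1 hq1
  have := qPochInf_neg_pos hq0 hq1 hq0
  have := qPochInf_neg_pos hq0 hq1 hz
  have := qPochInf_neg_pos hq0 hq1 (Real.rpow_pos_of_pos hq0 (-α))
  have : 0 < 1 - q := by linarith
  positivity

theorem rpow_natCast_add_eq (hq0 : 0 < q) (n : ℕ) :
    q ^ ((n : ℝ) + α + 1) = q ^ n * q ^ (α + 1) := by
  rw [← Real.rpow_natCast, ← Real.rpow_add hq0]; congr 1; ring

theorem rpow_neg_mul_add_eq (hq0 : 0 < q) (n : ℕ) :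
    q ^ (-((n : ℝ) * (n + α))) * (q ^ n * q ^ (α + 1)) ^ n = q ^ n := by
  rw [← rpow_natCast_add_eq hq0, ← Real.rpow_natCast, ← Real.rpow_natCast, ← Real.rpow_mul hq0.le,
    ← Real.rpow_add hq0]
  congr 1; ring

theorem coeff_qLaguerre (n k : ℕ) (hk : k ≤ n) : (qLaguerre α q n).coeff k =
    ((-1) ^ n * q ^ (-((n : ℝ) * (n + α))) * qPoch (q ^ (α + 1)) q n) *
      (qPoch ((q ^ n)⁻¹) q k * q ^ (k.choose 2) * (q ^ ((n : ℝ) + α + 1)) ^ k /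
        (qPoch (q ^ (α + 1)) q k * qPoch q q k)) := by
  rw [qLaguerre, Polynomial.coeff_C_mul, Polynomial.finsetSum_coeff, Finset.sum_eq_single k]
  · rw [Polynomial.coeff_C_mul, Polynomial.coeff_X_pow_self, mul_one]
  · intro j _ hj
    rw [Polynomial.coeff_C_mul_X_pow, if_neg (Ne.symm hj)]
  · intro h; simp at h; omega

theorem natDegree_qLaguerre_le (n : ℕ) : (qLaguerre α q n).natDegree ≤ n := by
  refine (Polynomial.natDegree_C_mul_le _ _).trans (Polynomial.natDegree_sum_le_of_forall_le _ _ ?_)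
  intro k hk
  refine (Polynomial.natDegree_C_mul_X_pow_le _ _).trans ?_
  simp at hk; omega

theorem coeff_qLaguerre_self (hq0 : 0 < q) (hq1 : q < 1) (hα : -1 < α) (n : ℕ) :
    (qLaguerre α q n).coeff n = 1 := by
  have h1 := (qPoch_pos hq0 hq1 hq1 n).ne'
  have h2 := (qPoch_pos hq0 hq1 (rpow_add_one_lt_one hq0 hq1 hα) n).ne'
  have h3 := qPoch_inv_pow_self hq0 n
  have h4 := rpow_neg_mul_add_eq (α := α) hq0 n
  rw [choose_two_succ, pow_add] at h3
  have h5 : ((-1 : ℝ) ^ n) * (-1) ^ n = 1 := by rw [← mul_pow]; simp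
  rw [coeff_qLaguerre n n le_rfl, rpow_natCast_add_eq hq0]
  rw [← mul_div_assoc, div_eq_one_iff_eq (mul_ne_zero h2 h1)]
  linear_combination ((-1) ^ n * qPoch (q ^ (α + 1)) q n * qPoch ((q ^ n)⁻¹) q n *
    q ^ (n.choose 2)) * h4 + (-1) ^ n * qPoch (q ^ (α + 1)) q n * h3 +
      qPoch (q ^ (α + 1)) q n * qPoch q q n * h5

theorem natDegree_qLaguerre (hq0 : 0 < q) (hq1 : q < 1) (hα : -1 < α) (n : ℕ) :
    (qLaguerre α q n).natDegree = n :=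
  Polynomial.natDegree_eq_of_le_of_coeff_ne_zero (natDegree_qLaguerre_le n)
    (by rw [coeff_qLaguerre_self hq0 hq1 hα]; exact one_ne_zero)

theorem monic_qLaguerre (hq0 : 0 < q) (hq1 : q < 1) (hα : -1 < α) (n : ℕ) :
    (qLaguerre α q n).Monic := by
  rw [Polynomial.Monic, Polynomial.leadingCoeff, natDegree_qLaguerre hq0 hq1 hα,
    coeff_qLaguerre_self hq0 hq1 hα]

/-- The squared norm of the monic `q`-Laguerre polynomial of degree `n`. -/
def laguerreNorm (hq0 : 0 < q) (hq1 : q < 1) (hα : -1 < α) (n : ℕ) : ℝ :=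
  laguerreFunctional hq0 hq1 hα 1 * q ^ (-(2 * (n : ℝ) * (n + α)) - n) *
    (qPoch (q ^ (α + 1)) q n * qPoch q q n)

/-- The moment of X^{m+k} contains (z;q)_{m+k} = (z;q)_k (zq^k;q)_m with z = q^{α+1}. Its first
factor cancels the denominator of the k-th coefficient, the powers of q leave q^{(n-m)k}, and the
sum is that of `sum_qPoch_mul_qPoch`. -/
theorem laguerreFunctional_X_pow_mul_qLaguerre (hq0 : 0 < q) (hq1 : q < 1) (hα : -1 < α)
    {m n : ℕ} (hmn : m ≤ n) :
    laguerreFunctional hq0 hq1 hα (Polynomial.X ^ m * qLaguerre α q n) =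
      if m = n then laguerreNorm hq0 hq1 hα n else 0 := by
  set L := laguerreFunctional hq0 hq1 hα with hL
  set z := q ^ (α + 1) with hz
  have hz0 : 0 < z := Real.rpow_pos_of_pos hq0 (α + 1)
  have hz1 : z < 1 := rpow_add_one_lt_one hq0 hq1 hα
  set A := (-1) ^ n * q ^ (-((n : ℝ) * (n + α))) * qPoch z q n with hA
  have h1 : L (Polynomial.X ^ m * qLaguerre α q n) = A * (L 1 / (z ^ m * q ^ (m.choose 2))) *
      ∑ k ∈ Finset.range (n + 1), qPoch ((q ^ n)⁻¹) q k / qPoch q q k * (q ^ (n - m)) ^ k *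
        qPoch (z * q ^ k) q m := by
    have h2 : Polynomial.X ^ m * qLaguerre α q n = A • ∑ k ∈ Finset.range (n + 1),
        ((qPoch ((q ^ n)⁻¹) q k * q ^ (k.choose 2) * (q ^ n * z) ^ k /
        (qPoch z q k * qPoch q q k)) • (Polynomial.X ^ (m + k) : ℝ[X])) := by
      rw [qLaguerre, rpow_natCast_add_eq hq0, ← Polynomial.C_mul', mul_left_comm, Finset.mul_sum]
      congr 1
      refine Finset.sum_congr rfl fun k _ => ?_
      rw [← Polynomial.C_mul', pow_add]; ring
    rw [h2, map_smul, map_sum, smul_eq_mul, mul_assoc A]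
    congr 1
    rw [Finset.mul_sum]
    refine Finset.sum_congr rfl fun k _ => ?_
    have h3 := laguerreFunctional_X_pow hq0 hq1 hα (m + k)
    rw [← hL, ← hz, choose_two_add, add_comm m k, qPoch_add, add_comm k m] at h3
    have h4 := (qPoch_pos hq0 hq1 hz1 k).ne'
    have h5 := (qPoch_pos hq0 hq1 hq1 k).ne'
    have h6 : L (Polynomial.X ^ (m + k)) = L 1 * (qPoch z q k * qPoch (z * q ^ k) q m) /
        (z ^ (m + k) * q ^ (m.choose 2 + k.choose 2 + m * k)) := by
      rw [eq_div_iff (by positivity), h3]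
    have h7 : (q ^ n) ^ k = (q ^ (n - m)) ^ k * q ^ (m * k) := by
      rw [← pow_mul, ← pow_mul, ← pow_add, ← add_mul]; congr 2; omega
    rw [map_smul, smul_eq_mul, h6, mul_pow, h7, pow_add, pow_add, pow_add]
    field_simp
  rw [h1, sum_qPoch_mul_qPoch hq0 hq1 z hmn]
  split_ifs with h
  · subst h
    rw [laguerreNorm, ← hz, ← hL, hA]
    have h2 := qPoch_inv_pow_self hq0 m
    have h3 : q ^ (-(2 * (m : ℝ) * (m + α)) - m) = q ^ (-((m : ℝ) * (m + α))) /
        (z ^ m * q ^ (m.choose 2) * q ^ ((m + 1).choose 2)) := by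
      have h5 := choose_two_add_succ m
      have h6 : ((m.choose 2 : ℕ) : ℝ) + ((m + 1).choose 2 : ℕ) = (m : ℝ) ^ 2 := by exact_mod_cast h5
      rw [hz, mul_assoc _ (q ^ m.choose 2), ← pow_add, h5, ← Real.rpow_natCast, ← Real.rpow_natCast,
        ← Real.rpow_mul hq0.le, ← Real.rpow_add hq0, ← Real.rpow_sub hq0]
      congr 1; push_cast; ring
    have h4 : ((-1 : ℝ) ^ m) * (-1) ^ m = 1 := by rw [← mul_pow]; simp
    rw [h3]
    have h5 : qPoch ((q ^ m)⁻¹) q m = (-1) ^ m * qPoch q q m / q ^ ((m + 1).choose 2) := by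
      rw [eq_div_iff (by positivity), h2]
    rw [h5]
    field_simp
    rw [sq, h4, one_mul]
  · simp

theorem laguerreNorm_pos (hq0 : 0 < q) (hq1 : q < 1) (hα : -1 < α) (n : ℕ) :
    0 < laguerreNorm hq0 hq1 hα n := by
  have h1 := qPoch_pos hq0 hq1 hq1 n
  have h2 := qPoch_pos hq0 hq1 (rpow_add_one_lt_one hq0 hq1 hα) n
  have h3 := laguerreFunctional_one_pos hq0 hq1 hα
  unfold laguerreNorm
  positivity

theorem laguerreFunctional_mul_qLaguerre_of_degree_lt (hq0 : 0 < q) (hq1 : q < 1) (hα : -1 < α)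
    {f : ℝ[X]} {n : ℕ} (hf : f.degree < n) :
    laguerreFunctional hq0 hq1 hα (f * qLaguerre α q n) = 0 := by
  refine linearMap_eq_zero_of_degree_lt (R := fun j => Polynomial.X ^ j)
    (fun j => Polynomial.monic_X_pow j) (fun j => Polynomial.natDegree_X_pow j)
    (laguerreFunctional hq0 hq1 hα ∘ₗ LinearMap.mulRight ℝ (qLaguerre α q n)) (fun j hj => ?_) hf
  simp [laguerreFunctional_X_pow_mul_qLaguerre hq0 hq1 hα hj.le, hj.ne]

theorem laguerreFunctional_qLaguerre_mul_qLaguerre (hq0 : 0 < q) (hq1 : q < 1) (hα : -1 < α)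
    (m n : ℕ) : laguerreFunctional hq0 hq1 hα (qLaguerre α q m * qLaguerre α q n) =
      if m = n then laguerreNorm hq0 hq1 hα n else 0 := by
  have hlt : ∀ {m n : ℕ}, m < n →
      laguerreFunctional hq0 hq1 hα (qLaguerre α q m * qLaguerre α q n) = 0 := fun h =>
    laguerreFunctional_mul_qLaguerre_of_degree_lt hq0 hq1 hα
      ((Polynomial.degree_le_natDegree.trans_lt
        (by rw [natDegree_qLaguerre hq0 hq1 hα]; exact_mod_cast h)))
  rcases lt_trichotomy m n with h | h | h
  · rw [hlt h, if_neg h.ne]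
  · subst h
    -- X^m and p_m differ by a polynomial of lower degree, hence have the same integral against p_m.
    have h1 := degree_sub_C_coeff_mul_lt (monic_qLaguerre hq0 hq1 hα m)
      (natDegree_qLaguerre hq0 hq1 hα m) (f := Polynomial.X ^ m)
      (by rw [Polynomial.degree_X_pow]; exact_mod_cast m.lt_succ_self)
    have h2 := laguerreFunctional_mul_qLaguerre_of_degree_lt hq0 hq1 hα h1
    rw [Polynomial.coeff_X_pow_self, Polynomial.C_1, one_mul, sub_mul, map_sub,
      laguerreFunctional_X_pow_mul_qLaguerre hq0 hq1 hα le_rfl, sub_eq_zero] at h2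
    rw [← h2]
  · rw [mul_comm, hlt h, if_neg h.ne']

end QLaguerre

theorem summable_mul_of_summable {β γ : Type*} {f : β → ℝ} {g : γ → ℝ} (hf : Summable f)
    (hg : Summable g) : Summable fun x : β × γ => f x.1 * g x.2 := by
  have h := Summable.mul_norm hf.norm hg.norm
  exact h.of_norm

/-! ### Ordered pairings of sequences on ℤ -/

section OrderedPairing

/-- The term of the ordered pairing of two sequences. -/
def orderedPairingTerm (u v : ℤ → ℝ) (t : ℤ × ℤ) : ℝ := if t.1 ≤ t.2 then u t.1 * v t.2 else 0

/-- The ordered pairing `∑_{s ≤ t} u_s v_t` of two sequences. -/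
def orderedPairing (u v : ℤ → ℝ) : ℝ := ∑' t : ℤ × ℤ, orderedPairingTerm u v t

variable {u v u' v' : ℤ → ℝ}

theorem summable_orderedPairingTerm (hu : Summable u) (hv : Summable v) :
    Summable (orderedPairingTerm u v) := by
  refine Summable.of_norm_bounded (summable_mul_of_summable hu hv).norm fun t => ?_
  unfold orderedPairingTerm
  split_ifs
  · exact le_rfl
  · rw [norm_zero]; exact norm_nonneg _

theorem injective_int_add_nat (e : ℤ) : Function.Injective fun n : ℕ => e + (n : ℤ) :=
  fun a b h => by simpa using h

theorem injective_int_sub_nat (e : ℤ) : Function.Injective fun n : ℕ => e - (n : ℤ) :=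
  fun a b h => by simpa using h

/-- This and the version summing over the left entry first isolate a one-sided tail of either
sequence, which can then be telescoped. -/
theorem orderedPairing_eq_tsum_left (hu : Summable u) (hv : Summable v) :
    orderedPairing u v = ∑' e : ℤ, u e * ∑' n : ℕ, v (e + n) := by
  have hs := summable_orderedPairingTerm hu hv
  rw [orderedPairing, hs.tsum_prod' fun b => hs.prod_factor b]
  refine tsum_congr fun e => ?_
  rw [← tsum_mul_left, ← (injective_int_add_nat e).tsum_eq]
  · exact tsum_congr fun n => by simp [orderedPairingTerm]
  · intro k hk
    by_cases h : e ≤ k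
    · exact ⟨(k - e).toNat, by simp; omega⟩
    · simp [orderedPairingTerm, h] at hk

theorem orderedPairing_eq_tsum_right (hu : Summable u) (hv : Summable v) :
    orderedPairing u v = ∑' o : ℤ, (∑' n : ℕ, u (o - n)) * v o := by
  have hs := (Equiv.prodComm ℤ ℤ).summable_iff.2 (summable_orderedPairingTerm hu hv)
  rw [orderedPairing, ← (Equiv.prodComm ℤ ℤ).tsum_eq]
  have h2 := hs.tsum_prod' fun b => hs.prod_factor b
  simp only [Function.comp] at h2
  rw [h2]
  refine tsum_congr fun o => ?_
  rw [← tsum_mul_right, ← (injective_int_sub_nat o).tsum_eq]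
  · exact tsum_congr fun n => by simp [orderedPairingTerm]
  · intro k hk
    by_cases h : k ≤ o
    · exact ⟨(o - k).toNat, by simp; omega⟩
    · simp [orderedPairingTerm, h] at hk

theorem summable_mul_add_nat (hu : Summable u) (hv : Summable v) :
    Summable fun t : ℤ × ℕ => u t.1 * v (t.1 + t.2) := by
  have hinj : Function.Injective fun t : ℤ × ℕ => (t.1, t.1 + (t.2 : ℤ)) := by
    rintro ⟨a, b⟩ ⟨c, d⟩ h
    simp only [Prod.mk.injEq] at h ⊢
    omega
  exact (summable_mul_of_summable hu hv).comp_injective hinj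

theorem orderedPairing_add_left (hu : Summable u) (hu' : Summable u') (hv : Summable v) :
    orderedPairing (fun s => u s + u' s) v = orderedPairing u v + orderedPairing u' v := by
  unfold orderedPairing
  rw [← (summable_orderedPairingTerm hu hv).tsum_add (summable_orderedPairingTerm hu' hv)]
  refine tsum_congr fun t => ?_
  unfold orderedPairingTerm
  split_ifs <;> ring

theorem orderedPairing_add_right (hu : Summable u) (hv : Summable v) (hv' : Summable v') :
    orderedPairing u (fun s => v s + v' s) = orderedPairing u v + orderedPairing u v' := by
  unfold orderedPairing
  rw [← (summable_orderedPairingTerm hu hv).tsum_add (summable_orderedPairingTerm hu hv')]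
  refine tsum_congr fun t => ?_
  unfold orderedPairingTerm
  split_ifs <;> ring

theorem orderedPairing_mul_left (c : ℝ) :
    orderedPairing (fun s => c * u s) v = c * orderedPairing u v := by
  unfold orderedPairing
  rw [← tsum_mul_left]
  refine tsum_congr fun t => ?_
  unfold orderedPairingTerm
  split_ifs <;> ring

theorem orderedPairing_mul_right (c : ℝ) :
    orderedPairing u (fun s => c * v s) = c * orderedPairing u v := by
  unfold orderedPairing
  rw [← tsum_mul_left]
  refine tsum_congr fun t => ?_
  unfold orderedPairingTerm
  split_ifs <;> ring

theorem tsum_int_even_add_odd {h : ℤ → ℝ} (hh : Summable h) :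
    ∑' k, h k = ∑' k, h (2 * k) + ∑' k, h (2 * k + 1) := by
  have hs := (Int.divModEquiv 2).symm.summable_iff.2 hh
  have h1 : Summable fun k : ℤ => h (2 * k) :=
    hh.comp_injective (i := fun k : ℤ => 2 * k) fun a b hab => by simpa using hab
  have h2 : Summable fun k : ℤ => h (2 * k + 1) :=
    hh.comp_injective (i := fun k : ℤ => 2 * k + 1) fun a b hab => by simpa using hab
  rw [← (Int.divModEquiv 2).symm.tsum_eq]
  have h3 := hs.tsum_prod' fun b => hs.prod_factor b
  simp only [Function.comp] at h3
  rw [h3, ← h1.tsum_add h2]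
  refine tsum_congr fun k => ?_
  rw [tsum_fintype, Fin.sum_univ_two]
  simp [Int.divModEquiv, mul_comm]

theorem tsum_telescope {g : ℕ → ℝ} (hg : Tendsto g atTop (𝓝 0))
    (hs : Summable fun n => g n - g (n + 1)) : ∑' n, (g n - g (n + 1)) = g 0 := by
  have h1 := hs.hasSum.tendsto_sum_nat
  simp only [Finset.sum_range_sub'] at h1
  simpa using tendsto_nhds_unique h1 (hg.const_sub (g 0))

end OrderedPairing

/-! ### The skew weight and its relation to the q-Laguerre weight -/

section SkewWeight

variable {p α : ℝ}

/-- `x ω(x)`, with `ω` the skew weight in base `p²`. -/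
def skewMass (α p x : ℝ) : ℝ := x * laguerreSkewWeight α (p ^ 2) x

theorem qPochInf_sq_mul (hp0 : 0 < p) (hp1 : p < 1) (a : ℝ) :
    qPochInf a p = qPochInf a (p ^ 2) * qPochInf (a * p) (p ^ 2) := by
  have hq0 : 0 < p ^ 2 := by positivity
  have hq1 : p ^ 2 < 1 := by nlinarith
  have h1 : ∀ n, qPoch a p (2 * n) = qPoch a (p ^ 2) n * qPoch (a * p) (p ^ 2) n := fun n => by
    induction n with
    | zero => simp [qPoch_zero]
    | succ n ih =>
      rw [show 2 * (n + 1) = 2 * n + 1 + 1 by ring, qPoch_succ, qPoch_succ, ih, qPoch_succ,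
        qPoch_succ, ← pow_mul]
      ring
  have h2 : Tendsto (fun n : ℕ => 2 * n) atTop atTop :=
    tendsto_atTop_mono (fun n => by simp only [id]; omega) tendsto_id
  refine tendsto_nhds_unique ((tendsto_qPoch hp0 hp1 a).comp h2) ?_
  refine Tendsto.congr (fun n => (h1 n).symm) ?_
  exact (tendsto_qPoch hq0 hq1 a).mul (tendsto_qPoch hq0 hq1 (a * p))

theorem skewMass_mul_sq (hp0 : 0 < p) (hp1 : p < 1) {x : ℝ} (hx : 0 < x) :
    skewMass α p (p ^ 2 * x) = p ^ (α + 1) * (1 + x) * skewMass α p x := by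
  have hq0 : 0 < p ^ 2 := by positivity
  have hq1 : p ^ 2 < 1 := by nlinarith
  have h1 := qPochInf_eq_mul hq0 hq1 (-x)
  have h2 := qPochInf_neg_pos hq0 hq1 (mul_pos hx hq0)
  have h3 : p ^ 2 * (p ^ 2) ^ ((α - 1) / 2) = p ^ (α + 1) := by
    rw [← Real.rpow_natCast, ← Real.rpow_mul hp0.le, ← Real.rpow_add hp0]
    congr 1; push_cast; ring
  unfold skewMass laguerreSkewWeight
  rw [h1, Real.mul_rpow hq0.le hx.le, ← h3, sub_neg_eq_add, neg_mul, mul_comm (p ^ 2) x]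
  have : 0 < 1 + x := by linarith
  field_simp

/-- The base-p² products at x and px interleave to the base-p product, and the constant q^{-(α+1)/8}
in ω is the one that leaves no power of p over. -/
theorem skewMass_mul_skewMass (hp0 : 0 < p) (hp1 : p < 1) {x : ℝ} (hx : 0 < x) :
    skewMass α p x * skewMass α p (p * x) = x * laguerreWeight α p x := by
  have hq0 : 0 < p ^ 2 := by positivity
  have hq1 : p ^ 2 < 1 := by nlinarith
  have h1 := qPochInf_sq_mul hp0 hp1 (-x)
  have h2 := qPochInf_neg_pos hq0 hq1 (mul_pos hp0 hx)
  have h3 := qPochInf_neg_pos hq0 hq1 hx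
  have h4 : p * ((p ^ 2) ^ (-(α + 1) / 8) * (p ^ 2) ^ (-(α + 1) / 8) * p ^ ((α - 1) / 2)) = 1 := by
    nth_rewrite 1 [← Real.rpow_one p]
    rw [← Real.rpow_natCast p 2, ← Real.rpow_mul hp0.le, ← Real.rpow_add hp0, ← Real.rpow_add hp0,
      ← Real.rpow_add hp0]
    convert Real.rpow_zero p using 2
    push_cast; ring
  have h5 : x * (x ^ ((α - 1) / 2) * x ^ ((α - 1) / 2)) = x ^ α := by
    nth_rewrite 1 [← Real.rpow_one x]
    rw [← Real.rpow_add hx, ← Real.rpow_add hx]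
    congr 1; ring
  unfold skewMass laguerreSkewWeight laguerreWeight
  rw [h1, Real.mul_rpow hp0.le hx.le, neg_mul, mul_comm x p, ← h5]
  rw [mul_div_assoc', mul_div_assoc', div_mul_div_comm, mul_div_assoc']
  congr 1
  linear_combination (x * x * (x ^ ((α - 1) / 2) * x ^ ((α - 1) / 2))) * h4

theorem summable_eval_mul_skewMass (hp0 : 0 < p) (hp1 : p < 1) (hα : -1 < α) (f : ℝ[X]) {y : ℝ}
    (hy : 0 < y) :
    Summable fun s : ℤ => f.eval (y * (p ^ 2) ^ s) * skewMass α p (y * (p ^ 2) ^ s) := by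
  have hq0 : 0 < p ^ 2 := by positivity
  have hq1 : p ^ 2 < 1 := by nlinarith
  set c := (p ^ 2) ^ (-(α + 1) / 8) * y * y ^ ((α - 1) / 2)
  have hm : ∀ s : ℤ, skewMass α p (y * (p ^ 2) ^ s) =
      c * ((p ^ (α + 1)) ^ s * (qPochInf (-(y * (p ^ 2) ^ s)) (p ^ 2))⁻¹) := fun s => by
    have h1 : (p ^ 2) ^ s * ((p ^ 2) ^ s) ^ ((α - 1) / 2) = (p ^ (α + 1)) ^ s := by
      rw [← Real.rpow_natCast, ← Real.rpow_intCast, ← Real.rpow_mul hp0.le, ← Real.rpow_intCast,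
        ← Real.rpow_mul hp0.le, ← Real.rpow_mul hp0.le, ← Real.rpow_add hp0]
      congr 1; push_cast; ring
    unfold skewMass laguerreSkewWeight
    rw [Real.mul_rpow hy.le (zpow_pos hq0 s).le, ← h1]
    simp only [c]
    ring
  have hz := Real.rpow_pos_of_pos hp0 (α + 1)
  have hz1 := rpow_add_one_lt_one hp0 hp1 hα
  have := summable_sum (s := Finset.range (f.natDegree + 1)) fun k _ =>
    (summable_zpow_mul_qPochInf_inv hq0 hq1 hy (t := p ^ (α + 1) * (p ^ 2) ^ k) (by positivity)
      (mul_lt_one_of_nonneg_of_lt_one_left hz.le hz1 (pow_le_one₀ hq0.le hq1.le))).mul_left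
        (f.coeff k * y ^ k * c)
  refine this.congr fun s => ?_
  rw [Polynomial.eval_eq_sum_range, Finset.sum_mul, hm]
  refine Finset.sum_congr rfl fun k _ => ?_
  rw [mul_pow, mul_zpow, ← zpow_natCast ((p ^ 2) ^ s) k, ← zpow_natCast (p ^ 2) k,
    zpow_comm (p ^ 2) s k]
  ring

end SkewWeight

/-! ### The skew form and the q-difference operator -/

section SkewForm

variable {p α : ℝ}

/-- The values of `f(x) x ω(x)` on the even sublattice. -/
def evenSeq (α p : ℝ) (f : ℝ[X]) (s : ℤ) : ℝ :=
  f.eval ((p ^ 2) ^ s) * skewMass α p ((p ^ 2) ^ s)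

/-- The values of `f(x) x ω(x)` on the odd sublattice. -/
def oddSeq (α p : ℝ) (f : ℝ[X]) (s : ℤ) : ℝ :=
  f.eval (p * (p ^ 2) ^ s) * skewMass α p (p * (p ^ 2) ^ s)

theorem summable_evenSeq (hp0 : 0 < p) (hp1 : p < 1) (hα : -1 < α) (f : ℝ[X]) :
    Summable (evenSeq α p f) := by
  have := summable_eval_mul_skewMass hp0 hp1 hα f one_pos
  simp only [one_mul] at this
  exact this

theorem summable_oddSeq (hp0 : 0 < p) (hp1 : p < 1) (hα : -1 < α) (f : ℝ[X]) :
    Summable (oddSeq α p f) :=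
  summable_eval_mul_skewMass hp0 hp1 hα f hp0

theorem skewInner_term_eq (hp0 : 0 < p) (f g : ℝ[X]) (e : ℤ) (n : ℕ) :
    (p ^ 2) ^ e * (p * (p ^ 2) ^ e * (p ^ 2) ^ n) * skewIntegrand (laguerreSkewWeight α (p ^ 2)) f g
      (p * (p ^ 2) ^ e * (p ^ 2) ^ n) ((p ^ 2) ^ e) =
    evenSeq α p g e * oddSeq α p f (e + n) - evenSeq α p f e * oddSeq α p g (e + n) := by
  have h : p * (p ^ 2) ^ (e + (n : ℤ)) = p * (p ^ 2) ^ e * (p ^ 2) ^ n := by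
    rw [zpow_add₀ (by positivity), zpow_natCast, mul_assoc]
  unfold evenSeq oddSeq skewIntegrand skewMass
  rw [h]
  ring

theorem skewIntegrable_laguerre (hp0 : 0 < p) (hp1 : p < 1) (hα : -1 < α) (f g : ℝ[X]) :
    SkewIntegrable (p ^ 2) (laguerreSkewWeight α (p ^ 2)) f g := by
  unfold SkewIntegrable
  rw [Real.sqrt_sq hp0.le]
  have h1 := summable_mul_add_nat (summable_evenSeq hp0 hp1 hα g) (summable_oddSeq hp0 hp1 hα f)
  have h2 := summable_mul_add_nat (summable_evenSeq hp0 hp1 hα f) (summable_oddSeq hp0 hp1 hα g)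
  exact (h1.sub h2).congr fun t => (skewInner_term_eq hp0 f g t.1 t.2).symm

/-- The outer variable lies on the even sublattice and the inner one on the odd sublattice with an
index at least as large; each of the two Jackson integrals contributes a factor 1 − p². -/
theorem skewInner_eq_orderedPairing (hp0 : 0 < p) (hp1 : p < 1) (hα : -1 < α) (f g : ℝ[X]) :
    skewInner (p ^ 2) (laguerreSkewWeight α (p ^ 2)) f g = (1 - p ^ 2) ^ 2 *
      (orderedPairing (evenSeq α p g) (oddSeq α p f) -
        orderedPairing (evenSeq α p f) (oddSeq α p g)) := by
  have ef := summable_evenSeq hp0 hp1 hα f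
  have eg := summable_evenSeq hp0 hp1 hα g
  have of := summable_oddSeq hp0 hp1 hα f
  have og := summable_oddSeq hp0 hp1 hα g
  have h1 : ∀ h : ℝ[X], ∀ e : ℤ, Summable fun n : ℕ => oddSeq α p h (e + n) := fun h e =>
    (summable_oddSeq hp0 hp1 hα h).comp_injective (injective_int_add_nat e)
  have h2 : ∀ f g : ℝ[X], Summable fun e : ℤ => evenSeq α p f e * ∑' n : ℕ, oddSeq α p g (e + n) :=
    fun f g => by
      have := summable_mul_add_nat (summable_evenSeq hp0 hp1 hα f) (summable_oddSeq hp0 hp1 hα g)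
      refine this.prod.congr fun e => ?_
      rw [← tsum_mul_left]
  rw [orderedPairing_eq_tsum_left eg of, orderedPairing_eq_tsum_left ef og,
    ← (h2 g f).tsum_sub (h2 f g), skewInner, jacksonInfty, pow_two (1 - p ^ 2), mul_assoc]
  congr 1
  rw [← tsum_mul_left]
  refine tsum_congr fun e => ?_
  rw [jacksonTo, mul_left_comm, Real.sqrt_sq hp0.le]
  congr 1
  rw [← tsum_mul_left, ← tsum_mul_left, ← tsum_mul_left,
    ← ((h1 f e).mul_left (evenSeq α p g e)).tsum_sub ((h1 g e).mul_left _)]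
  refine tsum_congr fun n => ?_
  rw [← skewInner_term_eq hp0]
  ring

theorem evenSeq_add (f g : ℝ[X]) :
    evenSeq α p (f + g) = fun s => evenSeq α p f s + evenSeq α p g s := by
  funext s; simp [evenSeq, add_mul]

theorem oddSeq_add (f g : ℝ[X]) :
    oddSeq α p (f + g) = fun s => oddSeq α p f s + oddSeq α p g s := by
  funext s; simp [oddSeq, add_mul]

theorem evenSeq_smul (c : ℝ) (f : ℝ[X]) :
    evenSeq α p (c • f) = fun s => c * evenSeq α p f s := by
  funext s; simp [evenSeq, mul_assoc]

theorem oddSeq_smul (c : ℝ) (f : ℝ[X]) :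
    oddSeq α p (c • f) = fun s => c * oddSeq α p f s := by
  funext s; simp [oddSeq, mul_assoc]

/-- The skew inner product as a bilinear form on polynomials. -/
def laguerreSkewForm (hp0 : 0 < p) (hp1 : p < 1) (hα : -1 < α) : ℝ[X] →ₗ[ℝ] ℝ[X] →ₗ[ℝ] ℝ :=
  have e := summable_evenSeq hp0 hp1 hα
  have o := summable_oddSeq hp0 hp1 hα
  LinearMap.mk₂ ℝ (skewInner (p ^ 2) (laguerreSkewWeight α (p ^ 2)))
    (fun f f' g => by
      simp only [skewInner_eq_orderedPairing hp0 hp1 hα, evenSeq_add, oddSeq_add,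
        orderedPairing_add_left (e f) (e f') (o g), orderedPairing_add_right (e g) (o f) (o f')]
      ring)
    (fun c f g => by
      simp only [skewInner_eq_orderedPairing hp0 hp1 hα, evenSeq_smul, oddSeq_smul,
        orderedPairing_mul_left, orderedPairing_mul_right, smul_eq_mul]
      ring)
    (fun f g g' => by
      simp only [skewInner_eq_orderedPairing hp0 hp1 hα, evenSeq_add, oddSeq_add,
        orderedPairing_add_left (e g) (e g') (o f), orderedPairing_add_right (e f) (o g) (o g')]
      ring)
    (fun c f g => by
      simp only [skewInner_eq_orderedPairing hp0 hp1 hα, evenSeq_smul, oddSeq_smul,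
        orderedPairing_mul_left, orderedPairing_mul_right, smul_eq_mul]
      ring)

theorem laguerreSkewForm_apply (hp0 : 0 < p) (hp1 : p < 1) (hα : -1 < α) (f g : ℝ[X]) :
    laguerreSkewForm hp0 hp1 hα f g = skewInner (p ^ 2) (laguerreSkewWeight α (p ^ 2)) f g := rfl

theorem laguerreSkewForm_swap (hp0 : 0 < p) (hp1 : p < 1) (hα : -1 < α) (f g : ℝ[X]) :
    laguerreSkewForm hp0 hp1 hα f g = -laguerreSkewForm hp0 hp1 hα g f := by
  simp only [laguerreSkewForm_apply, skewInner_eq_orderedPairing hp0 hp1 hα]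
  ring

/-- The `q`-difference operator `f ↦ f(x/p) - p^{α+1} (1 + x) f(px)`. -/
def laguerreD (α p : ℝ) : ℝ[X] →ₗ[ℝ] ℝ[X] where
  toFun f := f.comp (Polynomial.C p⁻¹ * Polynomial.X) -
    Polynomial.C (p ^ (α + 1)) * (1 + Polynomial.X) * f.comp (Polynomial.C p * Polynomial.X)
  map_add' f g := by simp only [Polynomial.add_comp]; ring
  map_smul' c f := by
    simp only [RingHom.id_apply, Polynomial.smul_eq_C_mul, Polynomial.mul_comp, Polynomial.C_comp]
    ring

theorem eval_laguerreD (f : ℝ[X]) (x : ℝ) : (laguerreD α p f).eval x =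
    f.eval (p⁻¹ * x) - p ^ (α + 1) * (1 + x) * f.eval (p * x) := by
  simp [laguerreD]

theorem coeff_laguerreD_succ (f : ℝ[X]) (n : ℕ) : (laguerreD α p f).coeff (n + 1) =
    f.coeff (n + 1) * p⁻¹ ^ (n + 1) -
      p ^ (α + 1) * (f.coeff (n + 1) * p ^ (n + 1) + f.coeff n * p ^ n) := by
  simp only [laguerreD, LinearMap.coe_mk, AddHom.coe_mk, Polynomial.coeff_sub,
    Polynomial.comp_C_mul_X_coeff, mul_assoc, Polynomial.coeff_C_mul, add_mul, one_mul,
    Polynomial.coeff_add, Polynomial.coeff_X_mul]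

/-- The factor p^{α+1}(1 + x) in the operator is the Pearson factor of the skew weight, so the
second term is the first one moved by a step of p². -/
theorem eval_laguerreD_mul_skewMass (hp0 : 0 < p) (hp1 : p < 1) (f : ℝ[X]) {x : ℝ} (hx : 0 < x) :
    (laguerreD α p f).eval (p * x) * skewMass α p (p * x) =
      f.eval x * skewMass α p (p * x) -
        f.eval (p ^ 2 * x) * skewMass α p (p * (p ^ 2 * x)) := by
  have h := skewMass_mul_sq (α := α) hp0 hp1 (mul_pos hp0 hx)
  rw [eval_laguerreD, show p * (p ^ 2 * x) = p ^ 2 * (p * x) by ring, h,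
    inv_mul_cancel_left₀ hp0.ne']
  ring_nf

theorem summable_shift (hp0 : 0 < p) (hp1 : p < 1) (hα : -1 < α) (f : ℝ[X]) {y : ℝ}
    (hy : 0 < y) :
    Summable fun s : ℤ => f.eval (y * (p ^ 2) ^ s) * skewMass α p (p * (y * (p ^ 2) ^ s)) := by
  have := summable_eval_mul_skewMass hp0 hp1 hα (f.comp (Polynomial.C p⁻¹ * Polynomial.X))
    (mul_pos hp0 hy)
  refine this.congr fun s => ?_
  simp only [Polynomial.eval_comp, Polynomial.eval_mul, Polynomial.eval_C, Polynomial.eval_X,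
    mul_assoc, inv_mul_cancel_left₀ hp0.ne']

/-- The tail telescopes to its first boundary term; the far boundary term vanishes as the term of a
convergent series. -/
theorem tsum_oddSeq_laguerreD (hp0 : 0 < p) (hp1 : p < 1) (hα : -1 < α) (f : ℝ[X]) (e : ℤ) :
    ∑' n : ℕ, oddSeq α p (laguerreD α p f) (e + n) =
      f.eval ((p ^ 2) ^ e) * skewMass α p (p * (p ^ 2) ^ e) := by
  have hq0 : 0 < p ^ 2 := by positivity
  set g : ℕ → ℝ := fun n =>
    f.eval ((p ^ 2) ^ (e + n)) * skewMass α p (p * (p ^ 2) ^ (e + n)) with hg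
  have h1 : ∀ n : ℕ, oddSeq α p (laguerreD α p f) (e + n) = g n - g (n + 1) := fun n => by
    have h2 : (p ^ 2) ^ (e + ((n + 1 : ℕ) : ℤ)) = p ^ 2 * (p ^ 2) ^ (e + (n : ℤ)) := by
      rw [← zpow_one_add₀ hq0.ne']; congr 1; push_cast; ring
    simp only [oddSeq, hg, h2, eval_laguerreD_mul_skewMass hp0 hp1 f (zpow_pos hq0 (e + n))]
  have hs := (summable_oddSeq hp0 hp1 hα (laguerreD α p f)).comp_injective
    (injective_int_add_nat e)
  have hgs : Summable g := by
    have := (summable_shift hp0 hp1 hα f one_pos).comp_injective (injective_int_add_nat e)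
    simpa only [one_mul, Function.comp_def] using this
  simp only [h1]
  rw [tsum_telescope hgs.tendsto_atTop_zero (hs.congr h1)]
  simp [hg]

/-- Here the sum runs towards larger points, so the surviving boundary term enters with a minus
sign. -/
theorem tsum_evenSeq_laguerreD (hp0 : 0 < p) (hp1 : p < 1) (hα : -1 < α) (f : ℝ[X]) (o : ℤ) :
    ∑' n : ℕ, evenSeq α p (laguerreD α p f) (o - n) =
      -(f.eval (p * (p ^ 2) ^ o) * skewMass α p (p * (p * (p ^ 2) ^ o))) := by
  have hq0 : 0 < p ^ 2 := by positivity
  set g : ℕ → ℝ := fun n =>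
    -(f.eval (p * (p ^ 2) ^ (o - n)) * skewMass α p (p * (p * (p ^ 2) ^ (o - n)))) with hg
  have h1 : ∀ n : ℕ, evenSeq α p (laguerreD α p f) (o - n) = g n - g (n + 1) := fun n => by
    have h2 : (p ^ 2) ^ (o - (n : ℤ)) = p ^ 2 * (p ^ 2) ^ (o - ((n + 1 : ℕ) : ℤ)) := by
      rw [← zpow_one_add₀ hq0.ne']; congr 1; push_cast; ring
    have h3 := eval_laguerreD_mul_skewMass (α := α) hp0 hp1 f
      (mul_pos hp0 (zpow_pos hq0 (o - ((n + 1 : ℕ) : ℤ))))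
    simp only [evenSeq, hg, h2]
    rw [show p ^ 2 * (p ^ 2) ^ (o - ((n + 1 : ℕ) : ℤ)) =
      p * (p * (p ^ 2) ^ (o - ((n + 1 : ℕ) : ℤ))) by ring, h3]
    ring_nf
  have hs := (summable_evenSeq hp0 hp1 hα (laguerreD α p f)).comp_injective
    (injective_int_sub_nat o)
  have hgs : Summable g :=
    ((summable_shift hp0 hp1 hα f hp0).comp_injective (injective_int_sub_nat o)).neg
  simp only [h1]
  rw [tsum_telescope hgs.tendsto_atTop_zero (hs.congr h1)]
  simp [hg]

/-- After telescoping, one pairing becomes the sum of xρfg over even powers of p and the other, with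
its extra sign, the sum over odd powers; together they fill p^ℤ. The constant compares the
normalisations of the double base-p² integral and the single base-p one. -/
theorem laguerreSkewForm_laguerreD (hp0 : 0 < p) (hp1 : p < 1) (hα : -1 < α) (f g : ℝ[X]) :
    laguerreSkewForm hp0 hp1 hα f (laguerreD α p g) =
      -((1 - p ^ 2) ^ 2 / (1 - p)) * laguerreFunctional hp0 hp1 hα (f * g) := by
  have hq0 : 0 < p ^ 2 := by positivity
  have hs : Summable fun s : ℤ => (f * g).eval (p ^ s) * (p ^ s * laguerreWeight α p (p ^ s)) := by
    have := jacksonIntegrable_laguerre hp0 hp1 hα (f * g)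
    exact this.congr fun s => by simp only [mul_left_comm]
  have he : ∀ k : ℤ, p ^ (2 * k) = (p ^ 2) ^ k := fun k => by
    rw [zpow_mul]; norm_cast
  have ho : ∀ k : ℤ, p ^ (2 * k + 1) = p * (p ^ 2) ^ k := fun k => by
    rw [zpow_add_one₀ hp0.ne', he, mul_comm]
  have h1p : 1 - p ≠ 0 := by linarith
  rw [laguerreSkewForm_apply, skewInner_eq_orderedPairing hp0 hp1 hα,
    orderedPairing_eq_tsum_left (summable_evenSeq hp0 hp1 hα f) (summable_oddSeq hp0 hp1 hα _),
    orderedPairing_eq_tsum_right (summable_evenSeq hp0 hp1 hα _) (summable_oddSeq hp0 hp1 hα f),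
    laguerreFunctional_apply, tsum_int_even_add_odd hs]
  have e1 : ∑' e, evenSeq α p f e * ∑' n : ℕ, oddSeq α p (laguerreD α p g) (e + n) =
      ∑' k : ℤ, (f * g).eval (p ^ (2 * k)) * (p ^ (2 * k) * laguerreWeight α p (p ^ (2 * k))) := by
    refine tsum_congr fun k => ?_
    rw [tsum_oddSeq_laguerreD hp0 hp1 hα, he, ← skewMass_mul_skewMass hp0 hp1 (zpow_pos hq0 k),
      evenSeq, Polynomial.eval_mul]
    ring
  have e2 : ∑' o, (∑' n : ℕ, evenSeq α p (laguerreD α p g) (o - n)) * oddSeq α p f o =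
      -∑' k : ℤ, (f * g).eval (p ^ (2 * k + 1)) *
        (p ^ (2 * k + 1) * laguerreWeight α p (p ^ (2 * k + 1))) := by
    rw [← tsum_neg]
    refine tsum_congr fun k => ?_
    rw [tsum_evenSeq_laguerreD hp0 hp1 hα, ho,
      ← skewMass_mul_skewMass hp0 hp1 (mul_pos hp0 (zpow_pos hq0 k)), oddSeq, Polynomial.eval_mul]
    ring
  rw [e1, e2]
  field_simp
  ring

/-- The substitution x ↦ px on the lattice, combined with the Pearson equation; it exchanges the two
terms of `laguerreD` under the integral. -/
theorem laguerreFunctional_mul_shift (hp0 : 0 < p) (hp1 : p < 1) (hα : -1 < α) (f g : ℝ[X]) :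
    laguerreFunctional hp0 hp1 hα (f * (Polynomial.C (p ^ (α + 1)) * (1 + Polynomial.X) *
        g.comp (Polynomial.C p * Polynomial.X))) =
      laguerreFunctional hp0 hp1 hα (g * f.comp (Polynomial.C p⁻¹ * Polynomial.X)) := by
  rw [laguerreFunctional_apply, laguerreFunctional_apply]
  congr 1
  rw [← (Equiv.addRight (1 : ℤ)).tsum_eq fun s : ℤ =>
    (g * f.comp (Polynomial.C p⁻¹ * Polynomial.X)).eval (p ^ s) *
      (p ^ s * laguerreWeight α p (p ^ s))]
  refine tsum_congr fun s => ?_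
  have h1 : p ^ (s + 1) = p * p ^ s := by rw [zpow_add_one₀ hp0.ne', mul_comm]
  simp only [Equiv.coe_addRight]
  rw [zpow_mul_laguerreWeight_succ hp0 hp1, h1]
  simp only [Polynomial.eval_mul, Polynomial.eval_C, Polynomial.eval_add, Polynomial.eval_one,
    Polynomial.eval_X, Polynomial.eval_comp, inv_mul_cancel_left₀ hp0.ne']
  ring

/-- The operator `laguerreD` is skew-symmetric for the `q`-Laguerre weight. -/
theorem laguerreFunctional_mul_laguerreD (hp0 : 0 < p) (hp1 : p < 1) (hα : -1 < α) (f g : ℝ[X]) :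
    laguerreFunctional hp0 hp1 hα (f * laguerreD α p g) =
      -laguerreFunctional hp0 hp1 hα (g * laguerreD α p f) := by
  simp only [laguerreD, LinearMap.coe_mk, AddHom.coe_mk, mul_sub, map_sub,
    laguerreFunctional_mul_shift hp0 hp1 hα]
  ring

end SkewForm

/-! ### Uniqueness of skew orthogonal families -/

section SkewUniqueness

variable {q : ℝ} {ω : ℝ → ℝ} {R Q : ℕ → ℝ[X]} {B : ℝ[X] →ₗ[ℝ] ℝ[X] →ₗ[ℝ] ℝ}

theorem IsSkewOrthogonalFamily.form_even_eq_zero (hR : IsSkewOrthogonalFamily q ω R)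
    (hB : ∀ f g, B f g = skewInner q ω f g) (hs : ∀ f g, B f g = -B g f) {n : ℕ} {f : ℝ[X]}
    (hf : f.degree < (2 * n + 1 : ℕ)) : B f (R (2 * n)) = 0 := by
  refine linearMap_eq_zero_of_degree_lt hR.monic hR.natDegree_eq (B.flip (R (2 * n)))
    (fun j hj => ?_) hf
  rw [LinearMap.flip_apply]
  obtain ⟨i, rfl | rfl⟩ := j.even_or_odd'
  · rw [hB, hR.even_even]
  · rw [hs, hB, hR.even_odd _ _ (by omega), neg_zero]

theorem IsSkewOrthogonalFamily.form_odd_eq_zero (hR : IsSkewOrthogonalFamily q ω R)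
    (hB : ∀ f g, B f g = skewInner q ω f g) {n : ℕ} {f : ℝ[X]}
    (hf : f.degree < (2 * n : ℕ)) : B f (R (2 * n + 1)) = 0 := by
  refine linearMap_eq_zero_of_degree_lt hR.monic hR.natDegree_eq (B.flip (R (2 * n + 1)))
    (fun j hj => ?_) hf
  rw [LinearMap.flip_apply]
  obtain ⟨i, rfl | rfl⟩ := j.even_or_odd'
  · rw [hB, hR.even_odd _ _ (by omega)]
  · rw [hB, hR.odd_odd]

theorem degree_lt_of_natDegree_lt {f : ℝ[X]} {n : ℕ} (h : f.natDegree < n) : f.degree < n :=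
  Polynomial.degree_le_natDegree.trans_lt (by exact_mod_cast h)

/-- Nondegeneracy on degree < 2n: pairing with R_{2n} detects the component along R_{2n+1}, then
pairing with R_{2n+1} detects the one along R_{2n}, so the degree drops by two at a time. -/
theorem IsSkewOrthogonalFamily.eq_zero_of_form_eq_zero (hR : IsSkewOrthogonalFamily q ω R)
    (hB : ∀ f g, B f g = skewInner q ω f g) (hs : ∀ f g, B f g = -B g f) {n : ℕ} {f : ℝ[X]}
    (hf : f.degree < (2 * n : ℕ)) (h : ∀ j < 2 * n, B f (R j) = 0) : f = 0 := by
  induction n with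
  | zero =>
    rw [Polynomial.degree_lt_iff_coeff_zero] at hf
    exact Polynomial.ext fun m => by simpa using hf m (Nat.zero_le m)
  | succ n ih =>
    have hu := hR.norm_ne_zero n
    have d1 := degree_sub_C_coeff_mul_lt (hR.monic (2 * n + 1)) (hR.natDegree_eq (2 * n + 1)) hf
    have c1 : f.coeff (2 * n + 1) = 0 := by
      have h1 := hR.form_even_eq_zero hB hs d1
      rw [map_sub, ← Polynomial.smul_eq_C_mul, map_smul, LinearMap.sub_apply, LinearMap.smul_apply,
        h (2 * n) (by omega), hs, hB, smul_eq_mul] at h1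
      simpa [hu] using h1
    rw [c1, Polynomial.C_0, zero_mul, sub_zero] at d1
    have d2 := degree_sub_C_coeff_mul_lt (hR.monic (2 * n)) (hR.natDegree_eq (2 * n)) d1
    have c2 : f.coeff (2 * n) = 0 := by
      have h1 := hR.form_odd_eq_zero hB d2
      rw [map_sub, ← Polynomial.smul_eq_C_mul, map_smul, LinearMap.sub_apply, LinearMap.smul_apply,
        h (2 * n + 1) (by omega), hB, smul_eq_mul] at h1
      simpa [hu] using h1
    rw [c2, Polynomial.C_0, zero_mul, sub_zero] at d2
    exact ih d2 fun j hj => h j (by omega)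

/-- Skew orthogonal families are unique up to adding multiples of `R_{2n}` to `R_{2n+1}`. -/
theorem IsSkewOrthogonalFamily.iff_exists (hR : IsSkewOrthogonalFamily q ω R)
    (hB : ∀ f g, B f g = skewInner q ω f g) (hs : ∀ f g, B f g = -B g f) :
    IsSkewOrthogonalFamily q ω Q ↔ ∃ a : ℕ → ℝ, ∀ n, Q (2 * n) = R (2 * n) ∧
      Q (2 * n + 1) = R (2 * n + 1) + Polynomial.C (a n) * R (2 * n) := by
  constructor
  · intro hQ
    have hdeg : ∀ j k, j < k → (R j).degree < (k : ℕ) := fun j k hjk =>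
      degree_lt_of_natDegree_lt (by rwa [hR.natDegree_eq])
    have hsub : ∀ k, (Q k - R k).degree < (k : ℕ) := fun k => by
      have h1 := degree_sub_C_coeff_mul_lt (hR.monic k) (hR.natDegree_eq k) (f := Q k)
        (degree_lt_of_natDegree_lt (by rw [hQ.natDegree_eq]; omega))
      have h2 := (hQ.monic k).coeff_natDegree
      rw [hQ.natDegree_eq] at h2
      rwa [h2, Polynomial.C_1, one_mul] at h1
    have he : ∀ {S : ℕ → ℝ[X]}, IsSkewOrthogonalFamily q ω S → ∀ n, ∀ j < 2 * n,
        B (S (2 * n)) (R j) = 0 := fun hS n j hj => by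
      rw [hs, hS.form_even_eq_zero hB hs (hdeg j _ (by omega)), neg_zero]
    have ho : ∀ {S : ℕ → ℝ[X]}, IsSkewOrthogonalFamily q ω S → ∀ n, ∀ j < 2 * n,
        B (S (2 * n + 1)) (R j) = 0 := fun hS n j hj => by
      rw [hs, hS.form_odd_eq_zero hB (hdeg j _ (by omega)), neg_zero]
    -- Subtracting this multiple of R_{2n} brings the difference down to degree < 2n, where
    -- nondegeneracy applies.
    refine ⟨fun n => (Q (2 * n + 1) - R (2 * n + 1)).coeff (2 * n), fun n => ⟨?_, ?_⟩⟩
    · rw [← sub_eq_zero]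
      refine hR.eq_zero_of_form_eq_zero hB hs (hsub (2 * n)) fun j hj => ?_
      rw [map_sub, LinearMap.sub_apply, he hQ n j hj, he hR n j hj, sub_zero]
    · rw [← sub_eq_zero, ← sub_sub]
      refine hR.eq_zero_of_form_eq_zero hB hs (degree_sub_C_coeff_mul_lt (hR.monic (2 * n))
        (hR.natDegree_eq (2 * n)) (hsub (2 * n + 1))) fun j hj => ?_
      rw [map_sub, map_sub, ← Polynomial.smul_eq_C_mul, map_smul, LinearMap.sub_apply,
        LinearMap.sub_apply, LinearMap.smul_apply, ho hQ n j hj, ho hR n j hj, he hR n j hj]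
      simp
  · rintro ⟨a, ha⟩
    have hlt : ∀ n, (Polynomial.C (a n) * R (2 * n)).degree < (R (2 * n + 1)).degree := fun n => by
      rw [Polynomial.degree_eq_natDegree (hR.monic _).ne_zero, hR.natDegree_eq]
      refine degree_lt_of_natDegree_lt ((Polynomial.natDegree_C_mul_le _ _).trans_lt ?_)
      rw [hR.natDegree_eq]; omega
    have hee : ∀ m n, B (R (2 * m)) (R (2 * n)) = 0 := fun m n => by rw [hB, hR.even_even]
    have heo : ∀ m n, B (R (2 * m)) (Q (2 * n + 1)) = B (R (2 * m)) (R (2 * n + 1)) := fun m n => by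
      rw [(ha n).2, ← Polynomial.smul_eq_C_mul, map_add, map_smul, hee, smul_zero, add_zero]
    refine ⟨fun k => ?_, fun k => ?_, fun m n => ?_, fun m n => ?_, fun m n hmn => ?_, fun n => ?_⟩
    · obtain ⟨n, rfl | rfl⟩ := k.even_or_odd'
      · rw [(ha n).1]; exact hR.monic _
      · rw [(ha n).2]; exact (hR.monic _).add_of_left (hlt n)
    · obtain ⟨n, rfl | rfl⟩ := k.even_or_odd'
      · rw [(ha n).1]; exact hR.natDegree_eq _
      · rw [(ha n).2, Polynomial.natDegree_add_eq_left_of_degree_lt (hlt n), hR.natDegree_eq]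
    · rw [(ha m).1, (ha n).1, hR.even_even]
    · have h1 : B (R (2 * m + 1)) (R (2 * n + 1)) = 0 := by rw [hB, hR.odd_odd]
      have h2 : m = n ∨ B (R (2 * m)) (R (2 * n + 1)) = 0 := by
        by_cases h : m = n
        · exact Or.inl h
        · right; rw [hB, hR.even_odd _ _ h]
      have h3 : m = n ∨ B (R (2 * n)) (R (2 * m + 1)) = 0 := by
        by_cases h : m = n
        · exact Or.inl h
        · right; rw [hB, hR.even_odd _ _ (Ne.symm h)]
      rw [← hB, (ha m).2, (ha n).2, ← Polynomial.smul_eq_C_mul, ← Polynomial.smul_eq_C_mul]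
      simp only [map_add, map_smul, LinearMap.add_apply, LinearMap.smul_apply, hee, h1,
        smul_eq_mul, mul_zero, add_zero, zero_add]
      -- Two cross terms remain: for m = n they cancel by antisymmetry, for m ≠ n each vanishes.
      rw [hs (R (2 * m + 1))]
      rcases h2 with rfl | h2
      · ring
      · rcases h3 with rfl | h3
        · ring
        · rw [h2, h3]; ring
    · rw [(ha m).1, ← hB, heo, hB, hR.even_odd _ _ hmn]
    · rw [(ha n).1, ← hB, heo, hB]; exact hR.norm_ne_zero n

end SkewUniqueness

/-! ### The q-Laguerre skew orthogonal family -/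

section LaguerreSkewFamily

variable {p α : ℝ}

theorem degree_qLaguerre_lt (hp0 : 0 < p) (hp1 : p < 1) (hα : -1 < α) {m n : ℕ} (h : m < n) :
    (qLaguerre α p m).degree < n :=
  degree_lt_of_natDegree_lt (by rwa [natDegree_qLaguerre hp0 hp1 hα])

theorem laguerreFunctional_qLaguerre_mul (hp0 : 0 < p) (hp1 : p < 1) (hα : -1 < α) {n : ℕ}
    {f : ℝ[X]} (hf : f.degree < (n + 1 : ℕ)) :
    laguerreFunctional hp0 hp1 hα (qLaguerre α p n * f) =
      f.coeff n * laguerreNorm hp0 hp1 hα n := by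
  have h1 := laguerreFunctional_mul_qLaguerre_of_degree_lt hp0 hp1 hα
    (degree_sub_C_coeff_mul_lt (monic_qLaguerre hp0 hp1 hα n) (natDegree_qLaguerre hp0 hp1 hα n) hf)
  rw [sub_mul, map_sub, mul_assoc, ← Polynomial.smul_eq_C_mul, map_smul,
    laguerreFunctional_qLaguerre_mul_qLaguerre, if_pos rfl, sub_eq_zero, smul_eq_mul] at h1
  rw [mul_comm, h1]

theorem eq_zero_of_laguerreFunctional_eq_zero (hp0 : 0 < p) (hp1 : p < 1) (hα : -1 < α) {n : ℕ}
    {f : ℝ[X]} (hf : f.degree < n)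
    (h : ∀ m < n, laguerreFunctional hp0 hp1 hα (qLaguerre α p m * f) = 0) : f = 0 := by
  induction n with
  | zero =>
    rw [Polynomial.degree_lt_iff_coeff_zero] at hf
    exact Polynomial.ext fun m => by simpa using hf m (Nat.zero_le m)
  | succ n ih =>
    have h1 := h n (Nat.lt_succ_self n)
    rw [laguerreFunctional_qLaguerre_mul hp0 hp1 hα hf] at h1
    have h2 := (mul_eq_zero_iff_right (laguerreNorm_pos hp0 hp1 hα n).ne').1 h1
    have h3 := degree_sub_C_coeff_mul_lt (monic_qLaguerre hp0 hp1 hα n)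
      (natDegree_qLaguerre hp0 hp1 hα n) hf
    rw [h2, Polynomial.C_0, zero_mul, sub_zero] at h3
    exact ih h3 fun m hm => h m (by omega)

theorem degree_laguerreD_lt {f : ℝ[X]} {n : ℕ} (hf : f.degree < n) :
    (laguerreD α p f).degree < (n + 1 : ℕ) := by
  rw [Polynomial.degree_lt_iff_coeff_zero] at hf ⊢
  intro m hm
  obtain ⟨k, rfl⟩ : ∃ k, m = k + 1 := ⟨m - 1, by omega⟩
  rw [coeff_laguerreD_succ, hf k (by omega), hf (k + 1) (by omega)]
  ring

theorem coeff_laguerreD_qLaguerre (hp0 : 0 < p) (hp1 : p < 1) (hα : -1 < α) (n : ℕ) :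
    (laguerreD α p (qLaguerre α p n)).coeff (n + 1) = -(p ^ (α + 1) * p ^ n) := by
  have h := (monic_qLaguerre hp0 hp1 hα n).coeff_natDegree
  rw [natDegree_qLaguerre hp0 hp1 hα] at h
  rw [coeff_laguerreD_succ, h, Polynomial.coeff_eq_zero_of_natDegree_lt
    (by rw [natDegree_qLaguerre hp0 hp1 hα]; omega)]
  ring

/-- The component along p_0 vanishes, since skew-symmetry makes the integral of f·Df zero. -/
theorem laguerreD_qLaguerre_zero (hp0 : 0 < p) (hp1 : p < 1) (hα : -1 < α) :
    laguerreD α p (qLaguerre α p 0) = Polynomial.C (-(p ^ (α + 1))) * qLaguerre α p 1 := by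
  have hd := degree_laguerreD_lt (α := α) (p := p)
    (degree_qLaguerre_lt hp0 hp1 hα (Nat.lt_succ_self 0))
  have h1 := degree_sub_C_coeff_mul_lt (monic_qLaguerre hp0 hp1 hα 1)
    (natDegree_qLaguerre hp0 hp1 hα 1) hd
  have hc := coeff_laguerreD_qLaguerre hp0 hp1 hα 0
  rw [zero_add, pow_zero, mul_one] at hc
  rw [hc] at h1
  rw [← sub_eq_zero]
  refine eq_zero_of_laguerreFunctional_eq_zero hp0 hp1 hα h1 fun m hm => ?_
  obtain rfl : m = 0 := by omega
  have h2 := laguerreFunctional_mul_laguerreD hp0 hp1 hα (qLaguerre α p 0) (qLaguerre α p 0)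
  rw [mul_sub, map_sub, mul_left_comm, ← Polynomial.smul_eq_C_mul, map_smul,
    laguerreFunctional_qLaguerre_mul_qLaguerre, if_neg (by omega), smul_zero, sub_zero]
  linarith

/-- The action of `laguerreD` on the `q`-Laguerre polynomials. -/
theorem laguerreD_qLaguerre_succ (hp0 : 0 < p) (hp1 : p < 1) (hα : -1 < α) (n : ℕ) :
    laguerreD α p (qLaguerre α p (n + 1)) =
      Polynomial.C (-(p ^ (α + 1) * p ^ (n + 1))) * qLaguerre α p (n + 2) +
      Polynomial.C (p ^ (α + 1) * p ^ n * laguerreNorm hp0 hp1 hα (n + 1) /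
        laguerreNorm hp0 hp1 hα n) * qLaguerre α p n := by
  set L := laguerreFunctional hp0 hp1 hα
  have hd := degree_laguerreD_lt (α := α) (p := p)
    (degree_qLaguerre_lt hp0 hp1 hα (Nat.lt_succ_self (n + 1)))
  have h1 := degree_sub_C_coeff_mul_lt (monic_qLaguerre hp0 hp1 hα (n + 2))
    (natDegree_qLaguerre hp0 hp1 hα (n + 2)) hd
  rw [coeff_laguerreD_qLaguerre hp0 hp1 hα (n + 1)] at h1
  rw [← sub_eq_zero, ← sub_sub]
  refine eq_zero_of_laguerreFunctional_eq_zero hp0 hp1 hα (n := n + 2)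
    ((Polynomial.degree_sub_le _ _).trans_lt (max_lt h1 ?_)) fun m hm => ?_
  · refine degree_lt_of_natDegree_lt ((Polynomial.natDegree_C_mul_le _ _).trans_lt ?_)
    rw [natDegree_qLaguerre hp0 hp1 hα]; omega
  have hn := laguerreNorm_pos hp0 hp1 hα n
  rw [mul_sub, mul_sub, map_sub, map_sub, mul_left_comm, mul_left_comm (qLaguerre α p m),
    ← Polynomial.smul_eq_C_mul, ← Polynomial.smul_eq_C_mul, map_smul, map_smul,
    laguerreFunctional_qLaguerre_mul_qLaguerre, laguerreFunctional_qLaguerre_mul_qLaguerre,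
    if_neg (by omega), smul_zero, sub_zero, laguerreFunctional_mul_laguerreD]
  -- The operator is moved onto p_m. For m < n the degree is too small; for m = n only the leading
  -- coefficient of D p_n contributes; for m = n + 1 the integral equals its own negative.
  rcases lt_trichotomy m n with h | rfl | h
  · have h2 := degree_laguerreD_lt (α := α) (p := p)
      (degree_qLaguerre_lt hp0 hp1 hα (Nat.lt_succ_self m))
    have h3 : (m + 1 + 1 : ℕ) ≤ n + 1 := by omega
    rw [mul_comm, laguerreFunctional_mul_qLaguerre_of_degree_lt hp0 hp1 hα
      (h2.trans_le (by exact_mod_cast h3)), if_neg (by omega)]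
    simp
  · have h2 := degree_laguerreD_lt (α := α) (p := p)
      (degree_qLaguerre_lt hp0 hp1 hα (Nat.lt_succ_self m))
    rw [laguerreFunctional_qLaguerre_mul hp0 hp1 hα h2, coeff_laguerreD_qLaguerre hp0 hp1 hα,
      if_pos rfl, smul_eq_mul]
    field_simp
    ring
  · obtain rfl : m = n + 1 := by omega
    have h2 := laguerreFunctional_mul_laguerreD hp0 hp1 hα (qLaguerre α p (n + 1))
      (qLaguerre α p (n + 1))
    rw [if_neg (by omega), smul_zero, sub_zero]
    linarith

/-- Makes the truncated index 2n − 1 = 0 at n = 0 harmless. -/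
theorem skewCoeff_zero : skewCoeff α (p ^ 2) 0 = 0 := by simp [skewCoeff]

theorem laguerreNorm_succ (hp0 : 0 < p) (hp1 : p < 1) (hα : -1 < α) (n : ℕ) :
    laguerreNorm hp0 hp1 hα (n + 1) = laguerreNorm hp0 hp1 hα n *
      (p ^ (-(4 * (n : ℝ) + 3 + 2 * α)) * (1 - p ^ (α + 1) * p ^ n) * (1 - p * p ^ n)) := by
  have h : p ^ (-(2 * ((n + 1 : ℕ) : ℝ) * ((n + 1 : ℕ) + α)) - ((n + 1 : ℕ) : ℝ)) =
      p ^ (-(2 * (n : ℝ) * (n + α)) - n) * p ^ (-(4 * (n : ℝ) + 3 + 2 * α)) := by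
    rw [← Real.rpow_add hp0]; congr 1; push_cast; ring
  unfold laguerreNorm
  rw [h, qPoch_succ, qPoch_succ]
  ring

/-- Identifies the lower coefficient of D p_{2n+2} in terms of its leading one; this is the source
of the coefficient in Q_{2n+1}. -/
theorem mul_laguerreNorm_div (hp0 : 0 < p) (hp1 : p < 1) (hα : -1 < α) (n : ℕ) :
    p ^ (α + 1) * p ^ (2 * n + 1) * laguerreNorm hp0 hp1 hα (2 * n + 2) /
        laguerreNorm hp0 hp1 hα (2 * n + 1) =
      p ^ (α + 1) * p ^ (2 * n + 2) * skewCoeff α (p ^ 2) (n + 1) := by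
  have hn := laguerreNorm_pos hp0 hp1 hα (2 * n + 1)
  have e1 : (p ^ 2) ^ (((n + 1 : ℕ) : ℝ) + α / 2) = p ^ (α + 1) * p ^ (2 * n + 1) := by
    rw [← Real.rpow_natCast, ← Real.rpow_mul hp0.le, ← Real.rpow_natCast, ← Real.rpow_add hp0]
    congr 1; push_cast; ring
  have e2 : (p ^ 2) ^ (-(4 * ((n + 1 : ℕ) : ℝ)) - α) =
      p ^ (-(4 * ((2 * n + 1 : ℕ) : ℝ) + 3 + 2 * α)) / p := by
    rw [← Real.rpow_natCast, ← Real.rpow_mul hp0.le]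
    nth_rewrite 3 [← Real.rpow_one p]
    rw [← Real.rpow_sub hp0]
    congr 1; push_cast; ring
  have e3 : (p ^ 2) ^ (n + 1) = p * p ^ (2 * n + 1) := by
    rw [← pow_mul]; ring
  rw [laguerreNorm_succ hp0 hp1 hα (2 * n + 1), skewCoeff, e1, e2, e3, pow_succ p (2 * n + 1)]
  field_simp

/-- The normalised skew orthogonal family attached to the `q`-Laguerre polynomials. -/
def laguerreSkewFamily (α p : ℝ) (k : ℕ) : ℝ[X] :=
  qLaguerre α p k - if k % 2 = 0 then 0 else
    Polynomial.C (skewCoeff α (p ^ 2) (k / 2)) * qLaguerre α p (2 * (k / 2) - 1)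

theorem laguerreSkewFamily_even (n : ℕ) :
    laguerreSkewFamily α p (2 * n) = qLaguerre α p (2 * n) := by
  simp [laguerreSkewFamily]

theorem laguerreSkewFamily_odd (n : ℕ) :
    laguerreSkewFamily α p (2 * n + 1) = qLaguerre α p (2 * n + 1) -
      Polynomial.C (skewCoeff α (p ^ 2) n) * qLaguerre α p (2 * n - 1) := by
  have h1 : (2 * n + 1) % 2 = 1 := by omega
  have h2 : (2 * n + 1) / 2 = n := by omega
  simp [laguerreSkewFamily, h1, h2]

theorem laguerreD_qLaguerre_even (hp0 : 0 < p) (hp1 : p < 1) (hα : -1 < α) (n : ℕ) :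
    laguerreD α p (qLaguerre α p (2 * n)) =
      (-(p ^ (α + 1) * p ^ (2 * n))) • laguerreSkewFamily α p (2 * n + 1) := by
  rw [laguerreSkewFamily_odd, Polynomial.smul_eq_C_mul]
  cases n with
  | zero => simp [laguerreD_qLaguerre_zero hp0 hp1 hα, skewCoeff_zero]
  | succ n =>
    rw [show 2 * (n + 1) = 2 * n + 1 + 1 by ring, laguerreD_qLaguerre_succ hp0 hp1 hα,
      mul_laguerreNorm_div hp0 hp1 hα]
    simp only [add_tsub_cancel_right, Polynomial.C_neg, Polynomial.C_mul]
    ring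

/-- As Q_{2n+1} is a multiple of D p_{2n}, pairing with it reduces to q-Laguerre orthogonality. -/
theorem laguerreSkewForm_odd (hp0 : 0 < p) (hp1 : p < 1) (hα : -1 < α) (f : ℝ[X]) (n : ℕ) :
    laguerreSkewForm hp0 hp1 hα f (laguerreSkewFamily α p (2 * n + 1)) =
      (1 - p ^ 2) ^ 2 / (1 - p) / (p ^ (α + 1) * p ^ (2 * n)) *
        laguerreFunctional hp0 hp1 hα (f * qLaguerre α p (2 * n)) := by
  have h := laguerreSkewForm_laguerreD hp0 hp1 hα f (qLaguerre α p (2 * n))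
  have h1 := Real.rpow_pos_of_pos hp0 (α + 1)
  rw [laguerreD_qLaguerre_even hp0 hp1 hα, map_smul, smul_eq_mul] at h
  have h2 : p ^ (α + 1) * p ^ (2 * n) ≠ 0 := by positivity
  rw [div_mul_eq_mul_div, eq_div_iff h2]
  linear_combination -h

/-- ⟨p_{2m}, D p_{2n+1}⟩ is proportional to the integral of p_{2m} p_{2n+1} and so vanishes, while D
p_{2n+1} combines p_{2n+2} and p_{2n}. Zeros thus propagate from n to n + 1, starting from ⟨p_0,p_0⟩
= 0 and then, by antisymmetry, from ⟨p_{2m},p_0⟩ = 0. -/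
theorem laguerreSkewForm_even_even (hp0 : 0 < p) (hp1 : p < 1) (hα : -1 < α) (m n : ℕ) :
    laguerreSkewForm hp0 hp1 hα (qLaguerre α p (2 * m)) (qLaguerre α p (2 * n)) = 0 := by
  have step : ∀ m n, laguerreSkewForm hp0 hp1 hα (qLaguerre α p (2 * m)) (qLaguerre α p (2 * n)) = 0 →
      laguerreSkewForm hp0 hp1 hα (qLaguerre α p (2 * m)) (qLaguerre α p (2 * (n + 1))) = 0 := by
    intro m n h
    have h1 := laguerreSkewForm_laguerreD hp0 hp1 hα (qLaguerre α p (2 * m)) (qLaguerre α p (2 * n + 1))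
    rw [laguerreD_qLaguerre_succ hp0 hp1 hα, map_add, ← Polynomial.smul_eq_C_mul,
      ← Polynomial.smul_eq_C_mul, map_smul, map_smul, h,
      laguerreFunctional_qLaguerre_mul_qLaguerre, if_neg (by omega), smul_zero, mul_zero,
      add_zero, smul_eq_mul] at h1
    have h2 := Real.rpow_pos_of_pos hp0 (α + 1)
    have h3 : -(p ^ (α + 1) * p ^ (2 * n + 1)) ≠ 0 := by
      have : 0 < p ^ (α + 1) * p ^ (2 * n + 1) := by positivity
      linarith
    exact (mul_eq_zero_iff_left h3).1 h1
  have base : ∀ n, laguerreSkewForm hp0 hp1 hα (qLaguerre α p (2 * 0)) (qLaguerre α p (2 * n)) = 0 := by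
    intro n
    induction n with
    | zero =>
      have := laguerreSkewForm_swap hp0 hp1 hα (qLaguerre α p (2 * 0)) (qLaguerre α p (2 * 0))
      linarith
    | succ n ih => exact step 0 n ih
  induction n with
  | zero => rw [laguerreSkewForm_swap, base, neg_zero]
  | succ n ih => exact step m n ih

theorem laguerreSkewForm_even_odd (hp0 : 0 < p) (hp1 : p < 1) (hα : -1 < α) (m n : ℕ) :
    laguerreSkewForm hp0 hp1 hα (laguerreSkewFamily α p (2 * m))
      (laguerreSkewFamily α p (2 * n + 1)) = if m = n then
        (1 - p ^ 2) ^ 2 / (1 - p) / (p ^ (α + 1) * p ^ (2 * n)) * laguerreNorm hp0 hp1 hα (2 * n)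
        else 0 := by
  rw [laguerreSkewForm_odd, laguerreSkewFamily_even, laguerreFunctional_qLaguerre_mul_qLaguerre]
  by_cases h : m = n
  · rw [if_pos (by omega), if_pos h]
  · rw [if_neg (by omega), if_neg h, mul_zero]

theorem laguerreSkewForm_odd_odd (hp0 : 0 < p) (hp1 : p < 1) (hα : -1 < α) (m n : ℕ) :
    laguerreSkewForm hp0 hp1 hα (laguerreSkewFamily α p (2 * m + 1))
      (laguerreSkewFamily α p (2 * n + 1)) = 0 := by
  rw [laguerreSkewForm_odd, laguerreSkewFamily_odd, sub_mul, map_sub, mul_assoc,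
    ← Polynomial.smul_eq_C_mul, map_smul, laguerreFunctional_qLaguerre_mul_qLaguerre,
    laguerreFunctional_qLaguerre_mul_qLaguerre, if_neg (by omega)]
  -- For m = 0 the truncated index is even and could meet 2n, but its coefficient is zero.
  cases m with
  | zero => simp [skewCoeff_zero]
  | succ m => rw [if_neg (by omega)]; simp

theorem isSkewOrthogonalFamily_laguerre (hp0 : 0 < p) (hp1 : p < 1) (hα : -1 < α) :
    IsSkewOrthogonalFamily (p ^ 2) (laguerreSkewWeight α (p ^ 2)) (laguerreSkewFamily α p) := by
  have hlt : ∀ n, (Polynomial.C (skewCoeff α (p ^ 2) n) * qLaguerre α p (2 * n - 1)).degree <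
      (qLaguerre α p (2 * n + 1)).degree := fun n => by
    rw [Polynomial.degree_eq_natDegree (monic_qLaguerre hp0 hp1 hα _).ne_zero,
      natDegree_qLaguerre hp0 hp1 hα]
    refine degree_lt_of_natDegree_lt ((Polynomial.natDegree_C_mul_le _ _).trans_lt ?_)
    rw [natDegree_qLaguerre hp0 hp1 hα]; omega
  refine ⟨fun k => ?_, fun k => ?_, fun m n => ?_, fun m n => ?_, fun m n hmn => ?_, fun n => ?_⟩
  · obtain ⟨n, rfl | rfl⟩ := k.even_or_odd'
    · rw [laguerreSkewFamily_even]; exact monic_qLaguerre hp0 hp1 hα _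
    · rw [laguerreSkewFamily_odd]
      exact (monic_qLaguerre hp0 hp1 hα _).sub_of_left (hlt n)
  · obtain ⟨n, rfl | rfl⟩ := k.even_or_odd'
    · rw [laguerreSkewFamily_even]; exact natDegree_qLaguerre hp0 hp1 hα _
    · rw [laguerreSkewFamily_odd, Polynomial.natDegree_sub_eq_left_of_natDegree_lt,
        natDegree_qLaguerre hp0 hp1 hα]
      refine (Polynomial.natDegree_C_mul_le _ _).trans_lt ?_
      rw [natDegree_qLaguerre hp0 hp1 hα, natDegree_qLaguerre hp0 hp1 hα]
      omega
  · rw [laguerreSkewFamily_even, laguerreSkewFamily_even, ← laguerreSkewForm_apply hp0 hp1 hα,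
      laguerreSkewForm_even_even]
  · rw [← laguerreSkewForm_apply hp0 hp1 hα, laguerreSkewForm_odd_odd]
  · rw [← laguerreSkewForm_apply hp0 hp1 hα, laguerreSkewForm_even_odd, if_neg hmn]
  · rw [← laguerreSkewForm_apply hp0 hp1 hα, laguerreSkewForm_even_odd, if_pos rfl]
    have h1 := laguerreNorm_pos hp0 hp1 hα (2 * n)
    have h2 := Real.rpow_pos_of_pos hp0 (α + 1)
    have h3 : 0 < 1 - p := by linarith
    have h4 : 0 < 1 - p ^ 2 := by nlinarith
    positivity

end LaguerreSkewFamily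

/-! ### Pfaffian sums and a discrete de Bruijn formula -/

section DeBruijn

theorem hasSum_pi_prod {β : Type*} {n : ℕ} (f : Fin n → β → ℝ) (hf : ∀ i, Summable (f i)) :
    HasSum (fun t : Fin n → β => ∏ i, f i (t i)) (∏ i, ∑' b, f i b) := by
  induction n with
  | zero => simp
  | succ n ih =>
    have h1 := ih (fun i => f i.succ) fun i => hf i.succ
    have h2 : (fun t : Fin (n + 1) → β => ∏ i, f i (t i)) ∘ (Fin.consEquiv fun _ => β) =
        fun x => f 0 x.1 * ∏ i : Fin n, f i.succ (x.2 i) := by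
      funext x
      simp [Fin.consEquiv, Fin.prod_univ_succ]
    rw [← (Fin.consEquiv fun _ => β).hasSum_iff, h2, Fin.prod_univ_succ]
    have h3 := summable_mul_of_summable (hf 0) h1.summable
    have h4 := (hf 0).hasSum.mul h1 h3
    exact h4

/-- The signed sum over permutations which is `n!` times the Pfaffian of the antisymmetrization
of `K`. -/
def pfaffianSum {n : ℕ} (K : Fin n × Bool → Fin n × Bool → ℝ) : ℝ :=
  ∑ σ : Equiv.Perm (Fin n × Bool),
    ((Equiv.Perm.sign σ : ℤ) : ℝ) * ∏ i, K (σ (i, false)) (σ (i, true))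

theorem sum_perm_bool (f : Equiv.Perm Bool → ℝ) : ∑ π, f π = f 1 + f (Equiv.swap false true) := by
  rw [show (Finset.univ : Finset (Equiv.Perm Bool)) = {1, Equiv.swap false true} by decide,
    Finset.sum_pair (by decide)]

theorem perm_bool_cases (π : Equiv.Perm Bool) : π = 1 ∨ π = Equiv.swap false true := by
  revert π; decide

/-- Each difference expands over the two permutations of `Bool`. Every choice of flips acts by right
multiplication on σ with a compensating sign, so all 2^n choices contribute equally. -/
theorem pfaffianSum_antisymm {n : ℕ} (K : Fin n × Bool → Fin n × Bool → ℝ) :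
    pfaffianSum (fun a b => K a b - K b a) = 2 ^ n * pfaffianSum K := by
  have h1 : ∀ σ : Equiv.Perm (Fin n × Bool),
      ∏ i, (K (σ (i, false)) (σ (i, true)) - K (σ (i, true)) (σ (i, false))) =
      ∑ π : Fin n → Equiv.Perm Bool, ((Equiv.Perm.sign (Equiv.prodCongrRight π) : ℤ) : ℝ) *
        ∏ i, K ((σ * Equiv.prodCongrRight π) (i, false)) ((σ * Equiv.prodCongrRight π) (i, true)) := by
    intro σ
    have h2 : ∀ i, K (σ (i, false)) (σ (i, true)) - K (σ (i, true)) (σ (i, false)) =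
        ∑ π : Equiv.Perm Bool, ((Equiv.Perm.sign π : ℤ) : ℝ) *
          K (σ (i, π false)) (σ (i, π true)) := fun i => by
      rw [sum_perm_bool]
      simp [sub_eq_add_neg]
    simp only [h2]
    rw [Finset.prod_univ_sum, Fintype.piFinset_univ]
    refine Finset.sum_congr rfl fun π _ => ?_
    rw [Finset.prod_mul_distrib, Equiv.Perm.sign_prodCongrRight]
    simp
  unfold pfaffianSum
  simp only [h1, Finset.mul_sum]
  rw [Finset.sum_comm]
  have h3 : ∀ π : Fin n → Equiv.Perm Bool,
      ∑ σ : Equiv.Perm (Fin n × Bool), ((Equiv.Perm.sign σ : ℤ) : ℝ) *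
        (((Equiv.Perm.sign (Equiv.prodCongrRight π) : ℤ) : ℝ) *
        ∏ i, K ((σ * Equiv.prodCongrRight π) (i, false))
          ((σ * Equiv.prodCongrRight π) (i, true))) = pfaffianSum K := by
    intro π
    refine Eq.trans (Finset.sum_congr rfl fun σ _ => ?_)
      (Equiv.sum_comp (Equiv.mulRight (Equiv.prodCongrRight π : Equiv.Perm (Fin n × Bool)))
        fun σ => ((Equiv.Perm.sign σ : ℤ) : ℝ) * ∏ i, K (σ (i, false)) (σ (i, true)))
    rw [Equiv.coe_mulRight, map_mul]
    push_cast
    ring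
  rw [Finset.sum_congr rfl fun π _ => h3 π, Finset.sum_const, Finset.card_univ, Fintype.card_fun,
    Fintype.card_perm, Fintype.card_bool, Fintype.card_fin, nsmul_eq_mul]
  norm_num [pfaffianSum, Finset.mul_sum]

/-- Only permutations mapping blocks to blocks survive. There are n!·2^n of them: moving whole
blocks is even because each has two elements, and the sign of an inner flip is absorbed by
antisymmetry. -/
theorem pfaffianSum_blockDiagonal {n : ℕ} {A : Fin n × Bool → Fin n × Bool → ℝ} {c : Fin n → ℝ}
    (hA : ∀ a b, A b a = -A a b) (h0 : ∀ a b, a.1 ≠ b.1 → A a b = 0)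
    (hc : ∀ i, A (i, false) (i, true) = c i) :
    pfaffianSum A = 2 ^ n * (n.factorial * ∏ i, c i) := by
  let e : Equiv.Perm (Fin n) × (Fin n → Equiv.Perm Bool) → Equiv.Perm (Fin n × Bool) := fun x =>
    Equiv.prodCongrLeft (fun _ => x.1) * Equiv.prodCongrRight x.2
  have he : ∀ x i b, e x (i, b) = (x.1 i, x.2 i b) := fun x i b => by simp [e]
  have hinj : Function.Injective e := by
    intro x y hxy
    have h : ∀ i b, (x.1 i, x.2 i b) = (y.1 i, y.2 i b) := fun i b => by
      rw [← he, ← he, hxy]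
    refine Prod.ext (Equiv.ext fun i => (Prod.mk.inj (h i true)).1) (funext fun i =>
      Equiv.ext fun b => (Prod.mk.inj (h i b)).2)
  have hval : ∀ x, ((Equiv.Perm.sign (e x) : ℤ) : ℝ) *
      ∏ i, A (e x (i, false)) (e x (i, true)) = ∏ i, c i := by
    intro x
    have h1 : ((Equiv.Perm.sign (e x) : ℤ) : ℝ) = ∏ i, ((Equiv.Perm.sign (x.2 i) : ℤ) : ℝ) := by
      simp only [e, map_mul, Equiv.Perm.sign_prodCongrRight, Equiv.Perm.sign_prodCongrLeft,
        Finset.prod_const, Finset.card_univ, Fintype.card_bool, Int.units_sq, one_mul]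
      simp
    rw [h1, ← Finset.prod_mul_distrib, ← Equiv.prod_comp x.1 c]
    refine Finset.prod_congr rfl fun i _ => ?_
    rw [he, he, ← hc]
    rcases perm_bool_cases (x.2 i) with h | h
    · simp [h]
    · simp [h, hA (x.1 i, false) (x.1 i, true)]
  have hsum := Fintype.sum_of_injective e hinj (fun _ => ∏ i, c i)
    (fun σ => ((Equiv.Perm.sign σ : ℤ) : ℝ) * ∏ i, A (σ (i, false)) (σ (i, true))) ?_
    (fun x => (hval x).symm)
  · rw [pfaffianSum, ← hsum, Finset.sum_const, Finset.card_univ, Fintype.card_prod, Fintype.card_fun,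
      Fintype.card_perm, Fintype.card_perm, Fintype.card_bool, Fintype.card_fin, nsmul_eq_mul]
    push_cast
    ring
  · intro σ hσ
    by_contra hne
    have hne2 := right_ne_zero_of_mul hne
    rw [Finset.prod_ne_zero_iff] at hne2
    -- A nonzero product forces σ to send both elements of each block into a common block, from
    -- which the preimage under e is rebuilt.
    have hfst : ∀ i b, (σ (i, b)).1 = (σ (i, false)).1 := fun i b => by
      cases b
      · rfl
      · by_contra h
        exact hne2 i (Finset.mem_univ i) (h0 _ _ (Ne.symm h))
    have hsurj : Function.Surjective fun i => (σ (i, false)).1 := fun j => by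
      refine ⟨(σ.symm (j, false)).1, ?_⟩
      simp only
      rw [← hfst _ (σ.symm (j, false)).2, Prod.mk.eta, Equiv.apply_symm_apply]
    have hinj2 : ∀ i, Function.Injective fun b => (σ (i, b)).2 := fun i b b' h => by
      have := σ.injective (Prod.ext ((hfst i b).trans (hfst i b').symm) h)
      exact (Prod.mk.inj this).2
    refine hσ ⟨(Equiv.ofBijective _ (Finite.injective_iff_bijective.1
      (Finite.injective_iff_surjective.2 hsurj)),
      fun i => Equiv.ofBijective _ (Finite.injective_iff_bijective.1 (hinj2 i))), ?_⟩
    refine Equiv.ext fun x => ?_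
    obtain ⟨i, b⟩ := x
    rw [he]
    exact Prod.ext (hfst i b).symm rfl

theorem pfaffianSum_eq {n : ℕ} {K : Fin n × Bool → Fin n × Bool → ℝ} {c : Fin n → ℝ}
    (h0 : ∀ a b, a.1 ≠ b.1 → K a b - K b a = 0)
    (hc : ∀ i, K (i, false) (i, true) - K (i, true) (i, false) = c i) :
    pfaffianSum K = n.factorial * ∏ i, c i := by
  have h1 := pfaffianSum_antisymm K
  rw [pfaffianSum_blockDiagonal (fun a b => by ring) h0 hc] at h1
  exact (mul_left_cancel₀ (by positivity) h1).symm

variable {n : ℕ} {u v : Fin n × Bool → ℤ → ℝ}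

/-- The matrix whose rows `(i, false)`, `(i, true)` are the values of `u` and `v` at the two
components of `t i`. -/
def configMatrix (u v : Fin n × Bool → ℤ → ℝ) (t : Fin n → ℤ × ℤ) :
    Matrix (Fin n × Bool) (Fin n × Bool) ℝ :=
  Matrix.of fun a b => if a.2 then v b (t a.1).2 else u b (t a.1).1

/-- The determinant of the configuration matrix, restricted to configurations of ordered pairs. -/
def configTerm (u v : Fin n × Bool → ℤ → ℝ) (t : Fin n → ℤ × ℤ) : ℝ :=
  open Classical in if ∀ i, (t i).1 ≤ (t i).2 then (configMatrix u v t).det else 0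

/-- In the Leibniz expansion the rows of a pair are grouped, so each permutation term is a product
over pairs and its sum over configurations factorises. -/
theorem configTerm_eq_sum (t : Fin n → ℤ × ℤ) : configTerm u v t =
    ∑ σ : Equiv.Perm (Fin n × Bool), ((Equiv.Perm.sign σ : ℤ) : ℝ) *
      ∏ i, orderedPairingTerm (u (σ (i, false))) (v (σ (i, true))) (t i) := by
  unfold configTerm
  split_ifs with h
  · rw [← Matrix.det_transpose, Matrix.det_apply']
    refine Finset.sum_congr rfl fun σ _ => ?_
    congr 1
    rw [Fintype.prod_prod_type]
    refine Finset.prod_congr rfl fun i _ => ?_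
    rw [Fintype.prod_bool]
    simp [configMatrix, orderedPairingTerm, h i, mul_comm]
  · push Not at h
    obtain ⟨i, hi⟩ := h
    refine (Finset.sum_eq_zero fun σ _ => ?_).symm
    rw [Finset.prod_eq_zero (Finset.mem_univ i), mul_zero]
    rw [orderedPairingTerm, if_neg (not_le.2 hi)]

theorem hasSum_configTerm (hu : ∀ a, Summable (u a)) (hv : ∀ a, Summable (v a)) :
    HasSum (configTerm u v) (pfaffianSum fun a b => orderedPairing (u a) (v b)) := by
  have h1 : configTerm u v = fun t => ∑ σ : Equiv.Perm (Fin n × Bool),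
      ((Equiv.Perm.sign σ : ℤ) : ℝ) *
      ∏ i, orderedPairingTerm (u (σ (i, false))) (v (σ (i, true))) (t i) :=
    funext configTerm_eq_sum
  rw [h1]
  refine hasSum_sum fun σ _ => HasSum.mul_left _ ?_
  exact hasSum_pi_prod _ fun i => summable_orderedPairingTerm (hu _) (hv _)

/-- Permuting the pairs permutes the false rows and the true rows alike, so the sign is squared. -/
theorem configTerm_comp_perm (t : Fin n → ℤ × ℤ) (σ : Equiv.Perm (Fin n)) :
    configTerm u v (t ∘ σ) = configTerm u v t := by
  have h1 : (∀ i, ((t ∘ σ) i).1 ≤ ((t ∘ σ) i).2) ↔ ∀ i, (t i).1 ≤ (t i).2 :=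
    ⟨fun h i => by simpa using h (σ.symm i), fun h i => h (σ i)⟩
  have h2 : configMatrix u v (t ∘ σ) =
      (configMatrix u v t).submatrix (Equiv.prodCongrLeft fun _ : Bool => σ) id := by
    ext a b
    simp [configMatrix]
  unfold configTerm
  rw [h2, Matrix.det_permute, Equiv.Perm.sign_prodCongrLeft]
  simp only [h1]
  simp

theorem configTerm_eq_zero_of_not_injective {t : Fin n → ℤ × ℤ}
    (h : ¬Function.Injective fun i => (t i).1) : configTerm u v t = 0 := by
  unfold configTerm
  split_ifs
  · simp only [Function.Injective, not_forall] at h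
    obtain ⟨i, j, hij, hne⟩ := h
    refine Matrix.det_zero_of_row_eq (i := (i, false)) (j := (j, false)) (by simpa using hne) ?_
    ext b
    simp [configMatrix, hij]
  · rfl

-- Equal first entries give equal rows and a zero determinant. Otherwise exactly one permutation
-- sorts the first entries, and by symmetry all n! orderings have the same sum.
open Classical in
theorem tsum_configTerm_eq_factorial_mul (hs : Summable (configTerm u v)) :
    ∑' t, configTerm u v t = n.factorial *
      ∑' t, if StrictMono (fun i => (t i).1) then configTerm u v t else 0 := by
  have h1 : ∀ t, configTerm u v t = ∑ σ : Equiv.Perm (Fin n),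
      if StrictMono (fun i => (t (σ i)).1) then configTerm u v t else 0 := by
    intro t
    by_cases hi : Function.Injective fun i => (t i).1
    · have hm := Tuple.monotone_sort fun i => (t i).1
      rw [Finset.sum_eq_single (Tuple.sort fun i => (t i).1), if_pos]
      · exact hm.strictMono_of_injective (hi.comp (Equiv.injective _))
      · intro σ _ hσ
        rw [if_neg]
        intro hsm
        have h2 := Tuple.unique_monotone (f := fun i => (t i).1) hsm.monotone hm
        exact hσ (Equiv.ext fun i => hi (congrFun h2 i))
      · intro h; exact absurd (Finset.mem_univ _) h
    · simp [configTerm_eq_zero_of_not_injective hi]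
  have h2 : ∀ σ : Equiv.Perm (Fin n), Summable fun t : Fin n → ℤ × ℤ =>
      if StrictMono (fun i => (t (σ i)).1) then configTerm u v t else 0 := fun σ => by
    refine Summable.of_norm_bounded hs.norm fun t => ?_
    split_ifs
    · exact le_rfl
    · simp
  rw [tsum_congr h1, Summable.tsum_finsetSum fun σ _ => h2 σ]
  have h3 : ∀ σ : Equiv.Perm (Fin n), (∑' t : Fin n → ℤ × ℤ,
      if StrictMono (fun i => (t (σ i)).1) then configTerm u v t else 0) =
      ∑' t, if StrictMono (fun i => (t i).1) then configTerm u v t else 0 := fun σ => by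
    rw [← (Equiv.arrowCongr σ (Equiv.refl (ℤ × ℤ))).tsum_eq]
    refine tsum_congr fun t => ?_
    have h4 : (Equiv.arrowCongr σ (Equiv.refl (ℤ × ℤ))) t = t ∘ σ.symm := by
      ext i <;> simp
    rw [h4, configTerm_comp_perm]
    simp
  simp only [h3]
  rw [Finset.sum_const, Finset.card_univ, Fintype.card_perm, Fintype.card_fin, nsmul_eq_mul]

/-- The pair with index `k` lies to the left of the pair with index `k + 1`. -/
def PairSeparated (t : Fin n → ℤ × ℤ) (k : ℕ) : Prop :=
  ∀ h : k + 1 < n, (t ⟨k, by omega⟩).2 < (t ⟨k + 1, h⟩).1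

/-- Ordered pairs with increasing first entries whose first `m` gaps are separated. -/
def SeparatedUpTo (t : Fin n → ℤ × ℤ) (m : ℕ) : Prop :=
  StrictMono (fun i => (t i).1) ∧ (∀ i, (t i).1 ≤ (t i).2) ∧ ∀ k < m, PairSeparated t k

/-- Exchange the second entries according to a permutation. -/
def permSnd (σ : Equiv.Perm (Fin n)) (t : Fin n → ℤ × ℤ) : Fin n → ℤ × ℤ :=
  fun i => ((t i).1, (t (σ i)).2)

theorem permSnd_swap_involutive (i j : Fin n) :
    Function.Involutive (permSnd (Equiv.swap i j)) := fun t => by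
  ext k <;> simp [permSnd]

theorem det_configMatrix_permSnd_swap (t : Fin n → ℤ × ℤ) {i j : Fin n} (hij : i ≠ j) :
    (configMatrix u v (permSnd (Equiv.swap i j) t)).det = -(configMatrix u v t).det := by
  have h2 : configMatrix u v (permSnd (Equiv.swap i j) t) =
      (configMatrix u v t).submatrix (Equiv.swap (i, true) (j, true)) id := by
    ext ⟨k, b⟩ c
    cases b
    · have : Equiv.swap (i, true) (j, true) (k, false) = (k, false) :=
        Equiv.swap_apply_of_ne_of_ne (by simp) (by simp)
      simp [configMatrix, permSnd, this]
    · have : Equiv.swap (i, true) (j, true) (k, true) = (Equiv.swap i j k, true) := by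
        simp only [Equiv.swap_apply_def, Prod.mk.injEq, and_true]
        split_ifs <;> rfl
      simp [configMatrix, permSnd, this]
  rw [h2, Matrix.det_permute, Equiv.Perm.sign_swap (by simpa using hij)]
  simp

/-- If o_m ≥ e_{m+1}, then exchanging o_m and o_{m+1} keeps both pairs ordered, because e_m <
e_{m+1} ≤ o_{m+1}, and still violates separation at m. Gaps before m involve neither entry, which is
why they are treated from left to right. -/
theorem SeparatedUpTo.permSnd_swap {t : Fin n → ℤ × ℤ} {m : ℕ} (hm : m + 1 < n)
    (h : SeparatedUpTo t m) (hn : ¬PairSeparated t m) :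
    SeparatedUpTo (permSnd (Equiv.swap ⟨m, by omega⟩ ⟨m + 1, hm⟩) t) m ∧
      ¬PairSeparated (permSnd (Equiv.swap ⟨m, by omega⟩ ⟨m + 1, hm⟩) t) m := by
  obtain ⟨h1, h2, h3⟩ := h
  simp only [PairSeparated, not_forall, not_lt] at hn
  obtain ⟨_, hn⟩ := hn
  have hlt := h1 (show (⟨m, by omega⟩ : Fin n) < ⟨m + 1, hm⟩ from Nat.lt_succ_self m)
  have hle := h2 ⟨m + 1, hm⟩
  simp only at hlt
  refine ⟨⟨h1, fun i => ?_, fun k hk hk2 => ?_⟩, ?_⟩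
  · simp only [permSnd, Equiv.swap_apply_def]
    split_ifs with hi hi'
    · subst hi; omega
    · subst hi'; omega
    · exact h2 i
  · have := h3 k hk hk2
    simp only [permSnd]
    rw [Equiv.swap_apply_of_ne_of_ne]
    · exact this
    · simp; omega
    · simp; omega
  · simp only [PairSeparated, not_forall, not_lt]
    refine ⟨hm, ?_⟩
    simp only [permSnd, Equiv.swap_apply_left]
    exact hle

theorem summable_ite_det_configMatrix (hs : Summable (configTerm u v))
    {P : (Fin n → ℤ × ℤ) → Prop} [DecidablePred P] (hP : ∀ t, P t → ∀ i, (t i).1 ≤ (t i).2) :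
    Summable fun t => if P t then (configMatrix u v t).det else 0 := by
  refine Summable.of_norm_bounded hs.norm fun t => ?_
  split_ifs with h
  · rw [configTerm, if_pos (hP t h)]
  · simp

-- At each gap the configurations violating separation cancel: exchanging second entries is an
-- involution on them that reverses the sign of the determinant.
open Classical in
theorem tsum_separatedUpTo (hs : Summable (configTerm u v)) (m : ℕ) :
    (∑' t, if StrictMono (fun i => (t i).1) then configTerm u v t else 0) =
      ∑' t, if SeparatedUpTo t m then (configMatrix u v t).det else 0 := by
  induction m with
  | zero =>
    refine tsum_congr fun t => ?_
    simp only [SeparatedUpTo, configTerm, Nat.not_lt_zero, false_imp_iff, implies_true, and_true,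
      ite_and]
  | succ m ih =>
    rw [ih]
    have hsep : ∀ t : Fin n → ℤ × ℤ,
        SeparatedUpTo t (m + 1) ↔ SeparatedUpTo t m ∧ PairSeparated t m := fun t => by
      simp only [SeparatedUpTo, Nat.lt_succ_iff_lt_or_eq, or_imp, forall_and, forall_eq, and_assoc]
    have h0 : (∑' t, if SeparatedUpTo t m ∧ ¬PairSeparated t m then
        (configMatrix u v t).det else 0) = 0 := by
      by_cases hm : m + 1 < n
      · set E : Equiv.Perm (Fin n → ℤ × ℤ) :=
          Function.Involutive.toPerm _ (permSnd_swap_involutive (⟨m, by omega⟩ : Fin n) ⟨m + 1, hm⟩)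
        have h1 := E.tsum_eq
          fun t => if SeparatedUpTo t m ∧ ¬PairSeparated t m then (configMatrix u v t).det else 0
        have h2 : ∀ t, (if SeparatedUpTo (E t) m ∧ ¬PairSeparated (E t) m then
            (configMatrix u v (E t)).det else 0) =
            -(if SeparatedUpTo t m ∧ ¬PairSeparated t m then (configMatrix u v t).det else 0) := by
          intro t
          have hE : E t = permSnd (Equiv.swap ⟨m, by omega⟩ ⟨m + 1, hm⟩) t := rfl
          rw [hE]
          have h3 : SeparatedUpTo (permSnd (Equiv.swap ⟨m, by omega⟩ ⟨m + 1, hm⟩) t) m ∧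
              ¬PairSeparated (permSnd (Equiv.swap ⟨m, by omega⟩ ⟨m + 1, hm⟩) t) m ↔
              SeparatedUpTo t m ∧ ¬PairSeparated t m := by
            refine ⟨fun h => ?_, fun h => h.1.permSnd_swap hm h.2⟩
            have := h.1.permSnd_swap hm h.2
            rwa [permSnd_swap_involutive] at this
          simp only [h3]
          rw [det_configMatrix_permSnd_swap t (by simp)]
          split_ifs
          · rfl
          · simp
        rw [tsum_congr h2, tsum_neg] at h1
        linarith
      · have h1 : ∀ t : Fin n → ℤ × ℤ, ¬(SeparatedUpTo t m ∧ ¬PairSeparated t m) :=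
          fun t h => h.2 fun hk => absurd hk hm
        simp [h1]
    have s1 := summable_ite_det_configMatrix hs (P := fun t => SeparatedUpTo t (m + 1))
      fun t ht => ht.2.1
    have s2 := summable_ite_det_configMatrix hs
      (P := fun t => SeparatedUpTo t m ∧ ¬PairSeparated t m) fun t ht => ht.1.2.1
    have h1 := s1.tsum_add s2
    rw [h0, add_zero] at h1
    rw [← h1]
    refine tsum_congr fun t => ?_
    rw [hsep]
    by_cases h1 : SeparatedUpTo t m <;> by_cases h2 : PairSeparated t m <;> simp [h1, h2]

open Classical in
/-- A discrete form of de Bruijn's integration formula. -/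
theorem tsum_separated_det_eq_prod (hu : ∀ a, Summable (u a)) (hv : ∀ a, Summable (v a))
    {c : Fin n → ℝ}
    (h0 : ∀ a b, a.1 ≠ b.1 → orderedPairing (u a) (v b) - orderedPairing (u b) (v a) = 0)
    (hc : ∀ i, orderedPairing (u (i, false)) (v (i, true)) -
      orderedPairing (u (i, true)) (v (i, false)) = c i) :
    ∑' t, (if SeparatedUpTo t n then (configMatrix u v t).det else 0) = ∏ i, c i := by
  have h1 := hasSum_configTerm hu hv
  have h2 := tsum_configTerm_eq_factorial_mul h1.summable
  rw [h1.tsum_eq, pfaffianSum_eq h0 hc, tsum_separatedUpTo h1.summable n] at h2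
  exact (mul_left_cancel₀ (by positivity) h2).symm

end DeBruijn

/-! ### Ordered indices as interlacing pairs -/

section OrderedConfig

variable {n : ℕ}

/-- The identification of `Fin n × Bool` with `Fin (2n)` sending `(i, b)` to `2i + b`. -/
def pairEquiv (n : ℕ) : Fin n × Bool ≃ Fin (2 * n) where
  toFun x := ⟨2 * x.1 + (if x.2 then 1 else 0), by have := x.1.2; split_ifs <;> omega⟩
  invFun k := (⟨k / 2, by have := k.2; omega⟩, decide ((k : ℕ) % 2 = 1))
  left_inv := by
    rintro ⟨i, b⟩
    cases b
    · simp
    · simp only [if_true, Prod.mk.injEq]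
      refine ⟨Fin.ext ?_, ?_⟩
      · simp; omega
      · simp
  right_inv := by
    intro k
    ext
    simp only [decide_eq_true_eq]
    split_ifs <;> omega

theorem pairEquiv_false (i : Fin n) : pairEquiv n (i, false) = ⟨2 * i, by omega⟩ := by
  simp [pairEquiv]

theorem pairEquiv_true (i : Fin n) : pairEquiv n (i, true) = ⟨2 * i + 1, by omega⟩ := by
  simp [pairEquiv]

/-- The configuration of pairs attached to an ordered index. -/
def orderedConfig (κ : OrderedIndex (2 * n)) : Fin n → ℤ × ℤ := fun i =>
  (κ.1 (pairEquiv n (i, false)) + i, κ.1 (pairEquiv n (i, true)) + i)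

theorem orderedConfig_injective : Function.Injective (orderedConfig (n := n)) := by
  intro κ κ' h
  refine Subtype.ext (funext fun k => ?_)
  obtain ⟨⟨i, b⟩, rfl⟩ := (pairEquiv n).surjective k
  have h1 := congrFun h i
  simp only [orderedConfig, Prod.mk.injEq, add_left_inj] at h1
  cases b
  · exact h1.1
  · exact h1.2

/-- The shift by i in `orderedConfig` turns the weak inequality between neighbouring pairs of κ into
the strict one required by separation. -/
theorem separatedUpTo_orderedConfig (κ : OrderedIndex (2 * n)) :
    SeparatedUpTo (orderedConfig κ) n := by
  refine ⟨fun i j hij => ?_, fun i => ?_, fun k hk hk2 => ?_⟩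
  · have h1 : pairEquiv n (i, false) ≤ pairEquiv n (j, false) := by
      rw [pairEquiv_false, pairEquiv_false, Fin.mk_le_mk]; have : (i : ℕ) < j := hij; omega
    have h2 := κ.2 h1
    have h3 : (i : ℤ) < (j : ℤ) := by exact_mod_cast hij
    simp only [orderedConfig]
    omega
  · have h1 : pairEquiv n (i, false) ≤ pairEquiv n (i, true) := by
      rw [pairEquiv_false, pairEquiv_true, Fin.mk_le_mk]; omega
    have h2 := κ.2 h1
    simp only [orderedConfig]
    omega
  · have h1 : pairEquiv n (⟨k, hk⟩, true) ≤ pairEquiv n (⟨k + 1, hk2⟩, false) := by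
      rw [pairEquiv_false, pairEquiv_true, Fin.mk_le_mk]; simp only; omega
    have h2 := κ.2 h1
    simp only [orderedConfig]
    push_cast
    omega

theorem monotone_fin_of_le_succ {N : ℕ} {f : Fin N → ℤ}
    (h : ∀ k (hk : k + 1 < N), f ⟨k, by omega⟩ ≤ f ⟨k + 1, hk⟩) : Monotone f := by
  have h1 : ∀ k l : ℕ, k ≤ l → ∀ (hk : k < N) (hl : l < N), f ⟨k, hk⟩ ≤ f ⟨l, hl⟩ := by
    intro k l hkl
    induction l, hkl using Nat.le_induction with
    | base => intro _ _; exact le_rfl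
    | succ l hkl ih => intro hk hl; exact (ih hk (by omega)).trans (h l hl)
  exact fun i j hij => h1 i j hij i.2 j.2

theorem exists_orderedConfig_eq {t : Fin n → ℤ × ℤ} (ht : SeparatedUpTo t n) :
    ∃ κ, orderedConfig κ = t := by
  obtain ⟨_, h2, h3⟩ := ht
  let g : Fin n × Bool → ℤ := fun x => (if x.2 then (t x.1).2 else (t x.1).1) - (x.1 : ℕ)
  have hmono : Monotone (g ∘ (pairEquiv n).symm) := by
    refine monotone_fin_of_le_succ fun k hk => ?_
    rcases k.even_or_odd' with ⟨i, rfl | rfl⟩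
    · have e1 : (⟨2 * i, by omega⟩ : Fin (2 * n)) = pairEquiv n (⟨i, by omega⟩, false) := by
        rw [pairEquiv_false]
      have e2 : (⟨2 * i + 1, hk⟩ : Fin (2 * n)) = pairEquiv n (⟨i, by omega⟩, true) := by
        rw [pairEquiv_true]
      have := h2 ⟨i, by omega⟩
      simp only [Function.comp, e1, e2, Equiv.symm_apply_apply, g]
      simpa using this
    · have e1 : (⟨2 * i + 1, by omega⟩ : Fin (2 * n)) = pairEquiv n (⟨i, by omega⟩, true) := by
        rw [pairEquiv_true]
      have e2 : (⟨2 * i + 1 + 1, hk⟩ : Fin (2 * n)) = pairEquiv n (⟨i + 1, by omega⟩, false) := by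
        rw [pairEquiv_false]; ext; simp only; ring
      have := h3 i (by omega) (by omega)
      simp only [Function.comp, e1, e2, Equiv.symm_apply_apply, g]
      simp
      omega
  refine ⟨⟨_, hmono⟩, funext fun i => ?_⟩
  simp [orderedConfig, g]

/-- There are n(2n − 1) factors, a number of the same parity as n. -/
theorem prod_prod_Ioi_sub_swap (z : Fin (2 * n) → ℝ) :
    ∏ i, ∏ j ∈ Finset.Ioi i, (z i - z j) = (-1) ^ n * ∏ i, ∏ j ∈ Finset.Ioi i, (z j - z i) := by
  have h1 : ∀ i, ∏ j ∈ Finset.Ioi i, (z i - z j) =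
      (-1) ^ (2 * n - 1 - (i : ℕ)) * ∏ j ∈ Finset.Ioi i, (z j - z i) := fun i => by
    rw [← Fin.card_Ioi, ← Finset.prod_const, ← Finset.prod_mul_distrib]
    exact Finset.prod_congr rfl fun j _ => by ring
  have h2 : ∀ n : ℕ, ∏ k ∈ Finset.range (2 * n), (-1 : ℝ) ^ k = (-1) ^ n := fun n => by
    induction n with
    | zero => simp
    | succ n ih =>
      rw [show 2 * (n + 1) = 2 * n + 1 + 1 by ring, Finset.prod_range_succ, Finset.prod_range_succ,
        ih, pow_succ (-1 : ℝ) (2 * n), pow_mul]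
      norm_num [pow_succ]
  simp only [h1]
  rw [Finset.prod_mul_distrib, Fin.prod_univ_eq_prod_range (fun i => (-1 : ℝ) ^ (2 * n - 1 - i)),
    Finset.prod_range_reflect, h2]

end OrderedConfig

/-! ### Evaluation of the ordered 2n-fold integral -/

section Ensemble

variable {p α : ℝ} {n : ℕ}

theorem orderedPoint_false (hp0 : 0 < p) (κ : OrderedIndex (2 * n)) (i : Fin n) :
    orderedPoint (p ^ 2) κ (pairEquiv n (i, false)) = (p ^ 2) ^ (orderedConfig κ i).1 := by
  have h : (p ^ 2) ^ (κ.1 (pairEquiv n (i, false)) + (i : ℤ)) =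
      (p ^ 2) ^ κ.1 (pairEquiv n (i, false)) * p ^ (2 * (i : ℕ)) := by
    rw [zpow_add₀ (by positivity), zpow_natCast, pow_mul]
  rw [orderedPoint, Real.sqrt_sq hp0.le, orderedConfig, h, pairEquiv_false]

theorem orderedPoint_true (hp0 : 0 < p) (κ : OrderedIndex (2 * n)) (i : Fin n) :
    orderedPoint (p ^ 2) κ (pairEquiv n (i, true)) = p * (p ^ 2) ^ (orderedConfig κ i).2 := by
  have h : (p ^ 2) ^ (κ.1 (pairEquiv n (i, true)) + (i : ℤ)) =
      (p ^ 2) ^ κ.1 (pairEquiv n (i, true)) * p ^ (2 * (i : ℕ)) := by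
    rw [zpow_add₀ (by positivity), zpow_natCast, pow_mul]
  rw [orderedPoint, Real.sqrt_sq hp0.le, orderedConfig, h, pairEquiv_true]
  ring

/-- The configuration determinant as a Vandermonde product. -/
theorem det_configMatrix_orderedConfig (hp0 : 0 < p) {R : ℕ → ℝ[X]} (hR : ∀ k, (R k).Monic)
    (hRn : ∀ k, (R k).natDegree = k) (κ : OrderedIndex (2 * n)) :
    (configMatrix (fun a => evenSeq α p (R (pairEquiv n a)))
      (fun a => oddSeq α p (R (pairEquiv n a))) (orderedConfig κ)).det =
      (-1) ^ n * ((p ^ 2) ^ (-(α + 1) / 8)) ^ (2 * n) *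
        orderedTerm (p ^ 2) (2 * n) (laguerreEnsembleIntegrand α (p ^ 2) (2 * n)) κ := by
  set z := orderedPoint (p ^ 2) κ with hz
  -- Row k carries the common factor `skewMass α p (z k)`; what remains is a matrix of monic
  -- polynomials of degrees 0, …, 2n − 1, with Vandermonde determinant.
  have h1 : configMatrix (fun a => evenSeq α p (R (pairEquiv n a)))
      (fun a => oddSeq α p (R (pairEquiv n a))) (orderedConfig κ) =
      (Matrix.of fun k l : Fin (2 * n) => skewMass α p (z k) *
        (Matrix.of fun k l : Fin (2 * n) => (R l).eval (z k)) k l).submatrix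
          (pairEquiv n) (pairEquiv n) := by
    ext ⟨i, b⟩ a
    cases b
    · simp [configMatrix, evenSeq, hz, orderedPoint_false hp0, mul_comm]
    · simp [configMatrix, oddSeq, hz, orderedPoint_true hp0, mul_comm]
  rw [h1, Matrix.det_submatrix_equiv_self, Matrix.det_mul_column,
    ← Matrix.det_eval_matrixOfPolynomials_eq_det_vandermonde z (fun k => R k) (fun k => hRn k)
      (fun k => hR k), Matrix.det_vandermonde, orderedTerm, laguerreEnsembleIntegrand, ← hz,
    prod_prod_Ioi_sub_swap]
  have h2 : ∏ k, skewMass α p (z k) = (∏ k, z k) * (((p ^ 2) ^ (-(α + 1) / 8)) ^ (2 * n) *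
      ∏ k, z k ^ ((α - 1) / 2) / qPochInf (-(z k)) (p ^ 2)) := by
    have h3 : ((p ^ 2) ^ (-(α + 1) / 8)) ^ (2 * n) =
        ∏ _k : Fin (2 * n), (p ^ 2) ^ (-(α + 1) / 8) := by simp
    rw [h3, ← Finset.prod_mul_distrib, ← Finset.prod_mul_distrib]
    refine Finset.prod_congr rfl fun k _ => ?_
    rw [skewMass, laguerreSkewWeight]
    ring
  have h4 : ((-1 : ℝ) ^ n) * (-1) ^ n = 1 := by rw [← mul_pow]; simp
  rw [h2]
  linear_combination (-(∏ k, z k) * (((p ^ 2) ^ (-(α + 1) / 8)) ^ (2 * n) *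
      ∏ k, z k ^ ((α - 1) / 2) / qPochInf (-(z k)) (p ^ 2)) *
      ∏ i, ∏ j ∈ Finset.Ioi i, (z j - z i)) * h4

/-- De Bruijn's formula applied to the skew orthogonal family. The sign (−1)^n from the blocks
cancels the one from the orientation of the Vandermonde product. -/
theorem hasSum_orderedTerm (hp0 : 0 < p) (hp1 : p < 1) (hα : -1 < α) (n : ℕ) :
    HasSum (orderedTerm (p ^ 2) (2 * n) (laguerreEnsembleIntegrand α (p ^ 2) (2 * n)))
      ((((p ^ 2) ^ (-(α + 1) / 8)) ^ (2 * n))⁻¹ * ∏ i ∈ Finset.range n,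
        (laguerreNorm hp0 hp1 hα (2 * i) / (1 - p) / (p ^ (α + 1) * p ^ (2 * i)))) := by
  classical
  have hR := isSkewOrthogonalFamily_laguerre hp0 hp1 hα
  set R := laguerreSkewFamily α p with hRdef
  have hp2 : (1 - p ^ 2) ^ 2 ≠ 0 := by
    have : 0 < 1 - p ^ 2 := by nlinarith
    positivity
  have hB : ∀ k l, (1 - p ^ 2) ^ 2 * (orderedPairing (evenSeq α p (R l)) (oddSeq α p (R k)) -
      orderedPairing (evenSeq α p (R k)) (oddSeq α p (R l))) =
      laguerreSkewForm hp0 hp1 hα (R k) (R l) := fun k l => by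
    rw [laguerreSkewForm_apply, skewInner_eq_orderedPairing hp0 hp1 hα]
  let u : Fin n × Bool → ℤ → ℝ := fun a => evenSeq α p (R (pairEquiv n a))
  let v : Fin n × Bool → ℤ → ℝ := fun a => oddSeq α p (R (pairEquiv n a))
  have hu : ∀ a, Summable (u a) := fun a => summable_evenSeq hp0 hp1 hα _
  have hv : ∀ a, Summable (v a) := fun a => summable_oddSeq hp0 hp1 hα _
  have h0 : ∀ a b : Fin n × Bool, a.1 ≠ b.1 →
      orderedPairing (u a) (v b) - orderedPairing (u b) (v a) = 0 := by
    rintro ⟨i, b⟩ ⟨j, c⟩ hij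
    have hij' : (i : ℕ) ≠ j := fun h => hij (Fin.ext h)
    have h1 := hB (pairEquiv n (j, c)) (pairEquiv n (i, b))
    refine (mul_eq_zero_iff_left hp2).1 (h1.trans ?_)
    cases b <;> cases c <;> simp only [pairEquiv_false, pairEquiv_true]
    · rw [laguerreSkewForm_apply, hR.even_even]
    · rw [laguerreSkewForm_swap, laguerreSkewForm_apply, hR.even_odd _ _ hij', neg_zero]
    · rw [laguerreSkewForm_apply, hR.even_odd _ _ (Ne.symm hij')]
    · rw [laguerreSkewForm_apply, hR.odd_odd]
  -- The minus sign reflects that the skew form is the reversed antisymmetrisation: its positive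
  -- pairing takes the second argument on the even sublattice.
  have hc : ∀ i : Fin n, orderedPairing (u (i, false)) (v (i, true)) -
      orderedPairing (u (i, true)) (v (i, false)) =
      -(laguerreNorm hp0 hp1 hα (2 * i) / (1 - p) / (p ^ (α + 1) * p ^ (2 * (i : ℕ)))) := by
    intro i
    have h1 := hB (pairEquiv n (i, false)) (pairEquiv n (i, true))
    simp only [pairEquiv_false, pairEquiv_true, hRdef] at h1
    rw [laguerreSkewForm_even_odd, if_pos rfl] at h1
    simp only [u, v, pairEquiv_false, pairEquiv_true, hRdef]
    refine mul_left_cancel₀ hp2 ?_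
    linear_combination -h1
  have hdet := det_configMatrix_orderedConfig (n := n) (α := α) hp0 hR.monic hR.natDegree_eq
  have hC : (-1 : ℝ) ^ n * ((p ^ 2) ^ (-(α + 1) / 8)) ^ (2 * n) ≠ 0 := by
    have : 0 < (p ^ 2) ^ (-(α + 1) / 8) := Real.rpow_pos_of_pos (by positivity) _
    refine mul_ne_zero (pow_ne_zero _ (by norm_num)) (pow_pos this _).ne'
  have hs := summable_ite_det_configMatrix (hasSum_configTerm hu hv).summable
    (P := fun t => SeparatedUpTo t n) fun t ht => ht.2.1
  have ht : (∑' t, if SeparatedUpTo t n then (configMatrix u v t).det else 0) =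
      (-1) ^ n * ∏ i ∈ Finset.range n,
        (laguerreNorm hp0 hp1 hα (2 * i) / (1 - p) / (p ^ (α + 1) * p ^ (2 * i))) := by
    have h1 := tsum_separated_det_eq_prod hu hv h0 hc
    rw [Finset.prod_neg, Finset.card_univ, Fintype.card_fin, Fin.prod_univ_eq_prod_range
      (fun i => laguerreNorm hp0 hp1 hα (2 * i) / (1 - p) / (p ^ (α + 1) * p ^ (2 * i)))] at h1
    rw [← h1]
  have hsum := hs.hasSum
  rw [ht, ← (orderedConfig_injective (n := n)).hasSum_iff (fun t h => if_neg fun h2 =>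
    h (exists_orderedConfig_eq h2))] at hsum
  have hcomp : ((fun t => if SeparatedUpTo t n then (configMatrix u v t).det else 0) ∘
      orderedConfig (n := n)) = fun κ => (-1) ^ n * ((p ^ 2) ^ (-(α + 1) / 8)) ^ (2 * n) *
        orderedTerm (p ^ 2) (2 * n) (laguerreEnsembleIntegrand α (p ^ 2) (2 * n)) κ := by
    funext κ
    rw [Function.comp_apply, if_pos (separatedUpTo_orderedConfig κ)]
    exact hdet κ
  rw [hcomp] at hsum
  have h5 := hsum.mul_left ((-1 : ℝ) ^ n * ((p ^ 2) ^ (-(α + 1) / 8)) ^ (2 * n))⁻¹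
  simp only [inv_mul_cancel_left₀ hC] at h5
  rwa [mul_inv, mul_comm ((-1 : ℝ) ^ n)⁻¹, mul_assoc,
    inv_mul_cancel_left₀ (pow_ne_zero _ (by norm_num))] at h5

/-- The exponent collects −8i² − 4iα − 2i from the norm of p_{2i} and −(α+1) − 2i from the leading
coefficient of D p_{2i}. -/
theorem prod_range_rpow (hp0 : 0 < p) (n : ℕ) :
    ∏ i ∈ Finset.range n, p ^ (-(α + 1) - 4 * (i : ℝ) - 8 * (i : ℝ) ^ 2 - 4 * i * α) =
      p ^ (-(α + 1) * n - 2 * n * (n - 1) * (4 * n + 1 + 3 * α) / 3) := by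
  induction n with
  | zero => simp
  | succ n ih =>
    rw [Finset.prod_range_succ, ih, ← Real.rpow_add hp0]
    congr 1
    push_cast
    ring

theorem orderedJackson_eq (hp0 : 0 < p) (hp1 : p < 1) (hα : -1 < α) (n : ℕ) :
    orderedJackson (p ^ 2) (2 * n) (laguerreEnsembleIntegrand α (p ^ 2) (2 * n)) =
      (2 : ℝ)⁻¹ ^ n * (1 - p ^ 2) ^ (2 * n) *
        (p ^ 2) ^ (-((n : ℝ) * (n - 1) * (4 * n + 1 + 3 * α) / 3) - (α + 1) / 4 * n) *
        ((qPochInf p p * qPochInf (-(p ^ (α + 1))) p * qPochInf (-(p ^ (-α))) p) ^ n /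
          (qPochInf (p ^ (α + 1)) p * qPochInf (-p) p * qPochInf (-p) p) ^ n) *
        ∏ i ∈ Finset.range n, (qPoch (p ^ (α + 1)) p (2 * i) * qPoch p p (2 * i)) := by
  have h1p : 1 - p ≠ 0 := by linarith
  have hi : ∀ i : ℕ, laguerreNorm hp0 hp1 hα (2 * i) / (1 - p) / (p ^ (α + 1) * p ^ (2 * i)) =
      (2 : ℝ)⁻¹ * (qPochInf p p * qPochInf (-(p ^ (α + 1))) p * qPochInf (-(p ^ (-α))) p /
        (qPochInf (p ^ (α + 1)) p * qPochInf (-p) p * qPochInf (-p) p)) *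
        p ^ (-(α + 1) - 4 * (i : ℝ) - 8 * (i : ℝ) ^ 2 - 4 * i * α) *
        (qPoch (p ^ (α + 1)) p (2 * i) * qPoch p p (2 * i)) := fun i => by
    have h1 : p ^ (-(α + 1) - 4 * (i : ℝ) - 8 * (i : ℝ) ^ 2 - 4 * i * α) =
        p ^ (-(2 * ((2 * i : ℕ) : ℝ) * ((2 * i : ℕ) + α)) - ((2 * i : ℕ) : ℝ)) /
          (p ^ (α + 1) * p ^ (2 * i)) := by
      rw [← Real.rpow_natCast p (2 * i), ← Real.rpow_add hp0, ← Real.rpow_sub hp0]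
      congr 1; push_cast; ring
    rw [laguerreNorm, laguerreFunctional_one, h1]
    generalize qPochInf p p * qPochInf (-(p ^ (α + 1))) p * qPochInf (-(p ^ (-α))) p = a
    generalize qPochInf (p ^ (α + 1)) p * qPochInf (-p) p * qPochInf (-p) p = b
    field_simp
  have hexp : (((p ^ 2) ^ (-(α + 1) / 8)) ^ (2 * n))⁻¹ *
      p ^ (-(α + 1) * n - 2 * n * (n - 1) * (4 * n + 1 + 3 * α) / 3) =
      (p ^ 2) ^ (-((n : ℝ) * (n - 1) * (4 * n + 1 + 3 * α) / 3) - (α + 1) / 4 * n) := by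
    rw [← Real.rpow_natCast p 2, ← Real.rpow_natCast _ (2 * n), ← Real.rpow_mul hp0.le,
      ← Real.rpow_mul hp0.le, ← Real.rpow_mul hp0.le, ← Real.rpow_neg hp0.le, ← Real.rpow_add hp0]
    congr 1; push_cast; ring
  rw [orderedJackson, (hasSum_orderedTerm hp0 hp1 hα n).tsum_eq, Finset.prod_congr rfl fun i _ => hi i,
    Finset.prod_mul_distrib, Finset.prod_mul_distrib, prod_range_rpow hp0, Finset.prod_const,
    Finset.card_range, ← hexp, mul_pow, div_pow]
  ring

end Ensemble

/-! ### Inversion of the two-term relation -/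

section InverseFormulas

variable {q α : ℝ}

/-- The coefficient of `Q_{2j+1}` in the expansion of the `q`-Laguerre polynomial of degree
`2n+1`. -/
def skewInvCoeff (α q : ℝ) (n j : ℕ) : ℝ :=
  q ^ (-((2 * (j : ℝ) + 2 * n + 2 + α) * ((n : ℝ) - j))) *
    (qPoch (q ^ (j + 1)) q (n - j) * qPoch (q ^ ((j : ℝ) + 1 + α / 2)) q (n - j))

theorem skewInvCoeff_self (n : ℕ) : skewInvCoeff α q n n = 1 := by
  simp [skewInvCoeff, qPoch_zero]

/-- The coefficients of the inverse of a bidiagonal system are products of consecutive off-diagonal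
entries, and this is the step from n to n + 1. -/
theorem skewInvCoeff_succ (hq : 0 < q) {n j : ℕ} (hj : j ≤ n) :
    skewInvCoeff α q (n + 1) j = skewCoeff α q (n + 1) * skewInvCoeff α q n j := by
  have h1 : q ^ (-((2 * (j : ℝ) + 2 * (n + 1 : ℕ) + 2 + α) * (((n + 1 : ℕ) : ℝ) - j))) =
      q ^ (-(4 * ((n + 1 : ℕ) : ℝ)) - α) * q ^ (-((2 * (j : ℝ) + 2 * n + 2 + α) * ((n : ℝ) - j))) := by
    rw [← Real.rpow_add hq]; congr 1; push_cast; ring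
  have h2 : q ^ (j + 1) * q ^ (n - j) = q ^ (n + 1) := by
    rw [← pow_add]; congr 1; omega
  have h3 : q ^ ((j : ℝ) + 1 + α / 2) * q ^ (n - j) = q ^ (((n + 1 : ℕ) : ℝ) + α / 2) := by
    rw [← Real.rpow_natCast, ← Real.rpow_add hq, Nat.cast_sub hj]; congr 1; push_cast; ring
  rw [skewInvCoeff, h1, show n + 1 - j = n - j + 1 by omega, qPoch_succ, qPoch_succ, h2, h3,
    skewInvCoeff, skewCoeff]
  ring

/-- Inversion of the two-term relation between two sequences of polynomials. -/
theorem skew_inverse_iff (hq : 0 < q) (P Q : ℕ → ℝ[X]) :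
    (∀ n, Q (2 * n) = P (2 * n) ∧
      Q (2 * n + 1) = P (2 * n + 1) - Polynomial.C (skewCoeff α q n) * P (2 * n - 1)) ↔
    ∀ n, P (2 * n) = Q (2 * n) ∧ P (2 * n + 1) = ∑ j ∈ Finset.range (n + 1),
      Polynomial.C (skewInvCoeff α q n j) * Q (2 * j + 1) := by
  have hc0 : skewCoeff α q 0 = 0 := by simp [skewCoeff]
  have hsucc : ∀ n, ∑ j ∈ Finset.range (n + 1 + 1),
      Polynomial.C (skewInvCoeff α q (n + 1) j) * Q (2 * j + 1) =
      Polynomial.C (skewCoeff α q (n + 1)) * (∑ j ∈ Finset.range (n + 1),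
        Polynomial.C (skewInvCoeff α q n j) * Q (2 * j + 1)) + Q (2 * (n + 1) + 1) := fun n => by
    rw [Finset.sum_range_succ, skewInvCoeff_self, Polynomial.C_1, one_mul, Finset.mul_sum]
    congr 1
    refine Finset.sum_congr rfl fun j hj => ?_
    rw [Finset.mem_range] at hj
    rw [skewInvCoeff_succ hq (by omega), Polynomial.C_mul, mul_assoc]
  constructor
  · intro h n
    refine ⟨(h n).1.symm, ?_⟩
    induction n with
    | zero =>
      have := (h 0).2
      simp only [hc0, Polynomial.C_0, zero_mul, sub_zero] at this
      simp [skewInvCoeff_self, ← this]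
    | succ n ih =>
      rw [hsucc, ← ih, (h (n + 1)).2, show 2 * (n + 1) - 1 = 2 * n + 1 by omega]
      ring
  · intro h n
    refine ⟨(h n).1.symm, ?_⟩
    cases n with
    | zero =>
      have := (h 0).2
      simp only [zero_add, Finset.sum_range_one, skewInvCoeff_self, Polynomial.C_1, one_mul] at this
      rw [this]
      simp [hc0]
    | succ n =>
      have := (h (n + 1)).2
      rw [hsucc, ← (h n).2] at this
      rw [this, show 2 * (n + 1) - 1 = 2 * n + 1 by omega]
      ring

end InverseFormulas

end

end

/-! ### Assembly of the theorem -/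

theorem mainTheorem10 (q α : ℝ) (hq0 : 0 < q) (hq1 : q < 1) (hα : -1 < α) :
    -- the monic q-Laguerre polynomials in base `q^{1/2}` and their orthogonality
    (∀ n, (qLaguerre α (√q) n).Monic ∧ (qLaguerre α (√q) n).natDegree = n) ∧
    (∀ φ : ℝ[X], JacksonIntegrable (√q) fun x => φ.eval x * laguerreWeight α (√q) x) ∧
    (∀ m n : ℕ,
      jacksonInfty (√q) (fun x => (qLaguerre α (√q) m).eval x * (qLaguerre α (√q) n).eval x *
          laguerreWeight α (√q) x) =
        if m = n then
          (1 - √q) / 2 * √q ^ (-(2 * (n : ℝ) * (n + α)) - n) *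
            (qPochInf (√q) (√q) * qPochInf (-(√q ^ (α + 1))) (√q) *
              qPochInf (-(√q ^ (-α))) (√q)) /
            (qPochInf (√q ^ (α + 1)) (√q) * qPochInf (-√q) (√q) * qPochInf (-√q) (√q)) *
            (qPoch (√q ^ (α + 1)) (√q) n * qPoch (√q) (√q) n)
        else 0) ∧
    -- the skew inner product is well defined on polynomials
    (∀ φ ψ : ℝ[X], SkewIntegrable q (laguerreSkewWeight α q) φ ψ) ∧
    -- the skew orthogonal families, up to adding a multiple of `Q_{2n}` to `Q_{2n+1}`
    (∀ Q : ℕ → ℝ[X], IsSkewOrthogonalFamily q (laguerreSkewWeight α q) Q ↔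
      ∃ a : ℕ → ℝ, ∀ n : ℕ,
        Q (2 * n) = qLaguerre α (√q) (2 * n) ∧
        Q (2 * n + 1) = qLaguerre α (√q) (2 * n + 1)
          + Polynomial.C (a n) * qLaguerre α (√q) (2 * n)
          - Polynomial.C (skewCoeff α q n) * qLaguerre α (√q) (2 * n - 1)) ∧
    -- the normalised skew orthogonal family
    (∀ Q : ℕ → ℝ[X],
      (IsSkewOrthogonalFamily q (laguerreSkewWeight α q) Q ∧
        ∀ n : ℕ, jacksonInfty (√q) (fun x => (Q (2 * n + 1)).eval x *
          (qLaguerre α (√q) (2 * n)).eval x * laguerreWeight α (√q) x) = 0) ↔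
      ∀ n : ℕ,
        Q (2 * n) = qLaguerre α (√q) (2 * n) ∧
        Q (2 * n + 1) = qLaguerre α (√q) (2 * n + 1)
          - Polynomial.C (skewCoeff α q n) * qLaguerre α (√q) (2 * n - 1)) ∧
    -- the equivalent inverse formulas
    (∀ Q : ℕ → ℝ[X],
      (∀ n : ℕ,
        Q (2 * n) = qLaguerre α (√q) (2 * n) ∧
        Q (2 * n + 1) = qLaguerre α (√q) (2 * n + 1)
          - Polynomial.C (skewCoeff α q n) * qLaguerre α (√q) (2 * n - 1)) ↔
      ∀ n : ℕ,
        qLaguerre α (√q) (2 * n) = Q (2 * n) ∧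
        qLaguerre α (√q) (2 * n + 1) = ∑ j ∈ Finset.range (n + 1),
          Polynomial.C (q ^ (-((2 * (j : ℝ) + 2 * n + 2 + α) * ((n : ℝ) - j))) *
            (qPoch (q ^ (j + 1)) q (n - j) * qPoch (q ^ ((j : ℝ) + 1 + α / 2)) q (n - j))) *
            Q (2 * j + 1)) ∧
    -- the ordered `2n`-fold q-integral
    (∀ n : ℕ,
      Summable (orderedTerm q (2 * n) (laguerreEnsembleIntegrand α q (2 * n))) ∧
      orderedJackson q (2 * n) (laguerreEnsembleIntegrand α q (2 * n)) =
        (2 : ℝ)⁻¹ ^ n * (1 - q) ^ (2 * n) *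
          q ^ (-((n : ℝ) * (n - 1) * (4 * n + 1 + 3 * α) / 3) - (α + 1) / 4 * n) *
          ((qPochInf (√q) (√q) * qPochInf (-(q ^ ((α + 1) / 2))) (√q) *
              qPochInf (-(q ^ (-α / 2))) (√q)) ^ n /
            (qPochInf (q ^ ((α + 1) / 2)) (√q) * qPochInf (-√q) (√q) *
              qPochInf (-√q) (√q)) ^ n) *
          ∏ i ∈ Finset.range n,
            (qPoch (q ^ ((α + 1) / 2)) (√q) (2 * i) * qPoch (√q) (√q) (2 * i))) := by
  -- With q written as p², both bases are powers of p and the square roots disappear.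
  obtain ⟨p, hp0, hp1, rfl⟩ : ∃ p : ℝ, 0 < p ∧ p < 1 ∧ q = p ^ 2 :=
    ⟨√q, Real.sqrt_pos.2 hq0, (Real.sqrt_lt' one_pos).2 (by simpa using hq1),
      (Real.sq_sqrt hq0.le).symm⟩
  have e1 : (p ^ 2) ^ ((α + 1) / 2) = p ^ (α + 1) := by
    rw [← Real.rpow_natCast, ← Real.rpow_mul hp0.le]; congr 1; push_cast; ring
  have e2 : (p ^ 2) ^ (-α / 2) = p ^ (-α) := by
    rw [← Real.rpow_natCast, ← Real.rpow_mul hp0.le]; congr 1; push_cast; ring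
  simp only [Real.sqrt_sq hp0.le, e1, e2]
  have hL : ∀ f g : ℝ[X], jacksonInfty p (fun x => f.eval x * g.eval x * laguerreWeight α p x) =
      laguerreFunctional hp0 hp1 hα (f * g) := fun f g => by
    simp [laguerreFunctional]
  have hR := isSkewOrthogonalFamily_laguerre hp0 hp1 hα
  have hfam : ∀ Q : ℕ → ℝ[X], IsSkewOrthogonalFamily (p ^ 2) (laguerreSkewWeight α (p ^ 2)) Q ↔
      ∃ a : ℕ → ℝ, ∀ n : ℕ, Q (2 * n) = qLaguerre α p (2 * n) ∧
        Q (2 * n + 1) = qLaguerre α p (2 * n + 1) + Polynomial.C (a n) * qLaguerre α p (2 * n) -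
          Polynomial.C (skewCoeff α (p ^ 2) n) * qLaguerre α p (2 * n - 1) := fun Q => by
    rw [hR.iff_exists (laguerreSkewForm_apply hp0 hp1 hα) (laguerreSkewForm_swap hp0 hp1 hα)]
    simp only [laguerreSkewFamily_even, laguerreSkewFamily_odd, sub_add_eq_add_sub]
  refine ⟨fun n => ⟨monic_qLaguerre hp0 hp1 hα n, natDegree_qLaguerre hp0 hp1 hα n⟩,
    jacksonIntegrable_laguerre hp0 hp1 hα, fun m n => ?_, skewIntegrable_laguerre hp0 hp1 hα,
    hfam, fun Q => ?_, fun Q => skew_inverse_iff hq0 (qLaguerre α p) Q, fun n =>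
      ⟨(hasSum_orderedTerm hp0 hp1 hα n).summable, orderedJackson_eq hp0 hp1 hα n⟩⟩
  · rw [hL, laguerreFunctional_qLaguerre_mul_qLaguerre]
    split_ifs
    · rw [laguerreNorm, laguerreFunctional_one]
      ring
    · rfl
  -- The normalising integral equals the free constant times a positive norm, so its vanishing
  -- singles out a_n = 0.
  · have hodd : ∀ (n : ℕ) (a : ℝ), laguerreFunctional hp0 hp1 hα
        ((qLaguerre α p (2 * n + 1) + Polynomial.C a * qLaguerre α p (2 * n) -
          Polynomial.C (skewCoeff α (p ^ 2) n) * qLaguerre α p (2 * n - 1)) *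
            qLaguerre α p (2 * n)) = a * laguerreNorm hp0 hp1 hα (2 * n) := fun n a => by
      rw [sub_mul, add_mul, map_sub, map_add, mul_assoc, mul_assoc, ← Polynomial.smul_eq_C_mul,
        ← Polynomial.smul_eq_C_mul, map_smul, map_smul, laguerreFunctional_qLaguerre_mul_qLaguerre,
        laguerreFunctional_qLaguerre_mul_qLaguerre, laguerreFunctional_qLaguerre_mul_qLaguerre,
        if_neg (by omega), if_pos rfl]
      cases n with
      | zero => simp [skewCoeff_zero]
      | succ n => rw [if_neg (by omega)]; simp
    rw [hfam]
    simp only [hL]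
    constructor
    · rintro ⟨⟨a, ha⟩, h⟩ n
      have h1 := h n
      rw [(ha n).2, hodd] at h1
      have h2 := (mul_eq_zero_iff_right (laguerreNorm_pos hp0 hp1 hα (2 * n)).ne').1 h1
      refine ⟨(ha n).1, ?_⟩
      rw [(ha n).2, h2, Polynomial.C_0, zero_mul, add_zero]
    · intro h
      refine ⟨⟨fun _ => 0, fun n => ⟨(h n).1, ?_⟩⟩, fun n => ?_⟩
      · rw [(h n).2, Polynomial.C_0, zero_mul, add_zero]
      · have h1 := hodd n 0
        rw [Polynomial.C_0, zero_mul, add_zero, zero_mul] at h1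
        rw [(h n).2, h1]
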